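/- Fix $\bar\epsilon\in(0,1)$. A state $\omega$ is uniform on $[-1,1]$. One of two speakers, the expert, observes $\omega$; the other, the quack, observes nothing. The speakers simultaneously send messages $m_1,m_2\in[-1,1]$ to a judge, who does not know which speaker is the expert, observes a signal $s=\omega+\epsilon$ with $\epsilon$ uniform on $[-\bar\epsilon,\bar\epsilon]$ independent of $\omega$, and selects exactly one speaker. A message $m$ is consistent with $s$ if $|m-s|\le\bar\epsilon$. A (measurable, possibly randomized) selection rule of the judge, which treats the two speakers symmetrically (interchanging the two messages interchanges the selection probabilities of the two speakers), follows the "max" rule $\phi_{\max}:[0,1]\to[0,1]$ if it selects the consistent speaker whenever exactly one message is consistent and, whenever both are consistent, selects the speaker whose message has the larger absolute value with probability $\phi_{\max}(\max\{|m_1|,|m_2|\})$; when both messages are $0$ and consistent, each speaker is selected with probability $\phi_{\max}(0)$ (so, by symmetry, $\phi_{\max}(0)=1/2$). Ties $|m_1|=|m_2|>0$, and the case of two inconsistent messages, are not restricted further. There exists a unique "max" rule $\phi_{\max}$ such that, if the expert always tells the truth (sends $\omega$) and the judge uses a selection rule that follows $\phi_{\max}$, then the quack is indifferent between all messages in $[-1,1]$: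 the probability that he is selected is the same for each of them. The rule $\phi_{\max}$ is strictly increasing on $[0,1]$ and maps $[0,1]$ onto $[1/2,\,1-\bar\epsilon/3]$. -/

import Mathlib

open MeasureTheory ProbabilityTheory

noncomputable section

/-- States of the world and messages are points of `[-1, 1]`. -/
abbrev Message : Type := Set.Icc (-1 : ℝ) 1

/-- The uniform probability distribution on the interval `[a, b]`. -/
def uniformLaw (a b : ℝ) : Measure (Set.Icc a b) :=
  ProbabilityTheory.cond ((volume : Measure ℝ).comap Subtype.val) Set.univ

/-- The message `m` is consistent with the judge's signal `s`. -/
def Consistent (ε : ℝ) (m : Message) (s : ℝ) : Prop :=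
  |(m : ℝ) - s| ≤ ε

/-- A measurable selection rule of the judge: `first m₁ m₂ s` is the probability that speaker 1 is
selected when speaker `i` sends the message `mᵢ` and the judge observes the signal `s`. The judge
has to select one speaker, so speaker 2 is selected with the complementary probability. -/
structure SelectionRule where
  first : Message → Message → ℝ → unitInterval
  measurable_first : Measurable fun x : Message × Message × ℝ => first x.1 x.2.1 x.2.2

/-- The probability that speaker `i` (`0` is speaker 1, `1` is speaker 2) is selected when he sends
`own`, the other speaker sends `other`, and the signal is `s`. -/
def SelectionRule.prob (φ : SelectionRule) (i : Fin 2) (own other : Message) (s : ℝ) : ℝ :=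
  if i = 0 then (φ.first own other s : ℝ) else 1 - (φ.first other own s : ℝ)

/-- The rule treats the two speakers symmetrically. -/
def SelectionRule.Symmetric (φ : SelectionRule) : Prop :=
  ∀ (m m' : Message) (s : ℝ), φ.prob 0 m m' s = φ.prob 1 m m' s

/-- The magnitude `max {|m₁|, |m₂|}` of the more extreme message. -/
def extremity (m₁ m₂ : Message) : unitInterval :=
  ⟨max |(m₁ : ℝ)| |(m₂ : ℝ)|,
    le_max_of_le_left (abs_nonneg _), max_le (abs_le.mpr m₁.2) (abs_le.mpr m₂.2)⟩

/-- `φ` treats the speakers symmetrically, selects the consistent speaker whenever exactly one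
message is consistent, and, when both are, selects the more extreme speaker with the probability
that `f` assigns to the magnitude of the more extreme message. If that magnitude is `0`, both
messages are `0`, and either speaker is a most extreme one. Ties at a positive magnitude and pairs
of inconsistent messages are restricted by symmetry only. -/
structure FollowsMaxRule (ε : ℝ) (f : unitInterval → unitInterval) (φ : SelectionRule) : Prop where
  symmetric : φ.Symmetric
  unique_consistent : ∀ (i : Fin 2) (m m' : Message) (s : ℝ),
    Consistent ε m s → ¬ Consistent ε m' s → φ.prob i m m' s = 1
  both_consistent : ∀ (i : Fin 2) (m m' : Message) (s : ℝ),
    Consistent ε m s → Consistent ε m' s → |(m' : ℝ)| < |(m : ℝ)| →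
      φ.prob i m m' s = f (extremity m m')
  both_consistent_zero : ∀ (i : Fin 2) (m m' : Message) (s : ℝ),
    Consistent ε m s → Consistent ε m' s → extremity m m' = 0 →
      φ.prob i m m' s = f (extremity m m')

/-- The expert's truthful strategy: in the state `ω` he sends the message `ω`. -/
def truthTelling : Kernel Message Message := Kernel.id

/-- The probability that the quack is selected if he is speaker `q` and sends `m`: the state is
uniform on `[-1, 1]`, the expert draws his message from `F ω`, and the judge's signal is the state
plus an independent noise that is uniform on `[-ε, ε]`. -/
def quackPayoff (ε : ℝ) (F : Kernel Message Message) (φ : SelectionRule) (q : Fin 2)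
    (m : Message) : ℝ :=
  ∫ ω : Message, ∫ m' : Message, ∫ e : Set.Icc (-ε) ε, φ.prob q m m' ((ω : ℝ) + (e : ℝ))
    ∂(uniformLaw (-ε) ε) ∂(F ω) ∂(uniformLaw (-1) 1)

/-- Whichever speaker he is, the quack gets the same payoff from every message if the expert always
tells the truth. -/
def QuackIndifferent (ε : ℝ) (φ : SelectionRule) : Prop :=
  ∀ (q : Fin 2) (m m' : Message),
    quackPayoff ε truthTelling φ q m = quackPayoff ε truthTelling φ q m'

end

/-! Write K for `pairKernel`, S for `kernelMass`, r for `ramp`. A truthful expert is always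
consistent and ties have probability zero, so twice the quack's payoff at magnitude a is V(a) = g(a)
S(a) + ∫_a^1 (1 - g(w)) K(a, w) dw (`quackPayoff_eq`). The claim is that "V is constant" has exactly
one solution g.

Uniqueness: K is symmetric, so g cancels when V is integrated over [0, 1] and the order of
integration is exchanged; the constant must be ∫ S = ε - ε²/3 (`maxRuleValue_eq_of_const`). Two
solutions then differ by a solution of a homogeneous Volterra equation, which vanishes
(`eq_zero_of_mul_kernelMass_eq`). At magnitude 0 symmetry forces 1/2, and V(1) = g(1) ε gives the
top value 1 - ε/3.

Existence: put g = (1 + k) / 2. Then V' = 0 becomes S k' + (4 - 3r) k = J, where J = `windowMean ε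
k` involves k only at more extreme states. With the integrating factor λ this is (λ S k)' = λ J, so
k(a) is the average of J / (4 - 3r) over [0, a] with density λ (4 - 3r). J increases and 4 - 3r
decreases, so this averaging preserves monotone functions; it is also monotone in k. Knaster-Tarski
gives a fixed point (`exists_avg_eq_self`), whose continuity and strict monotonicity are read off
from the averages. -/

noncomputable section

/-! ### The consistency kernel and its mass -/

/-- The probability that a message at distance `|x|` from the state is consistent with the
signal. -/
def tent (ε x : ℝ) : ℝ := max 0 (1 - |x| / (2 * ε))

/-- The probability weight that a quack's message of magnitude `a` is consistent, summed over the
two states of magnitude `w`. -/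
def pairKernel (ε a w : ℝ) : ℝ := tent ε (a - w) + tent ε (a + w)

/-- The integral of `pairKernel ε a` over the states less extreme than `a`. -/
def kernelMass (ε a : ℝ) : ℝ := ∫ w in (0 : ℝ)..a, pairKernel ε a w

/-- The ratio `s / ε` capped at `1`. -/
def ramp (ε s : ℝ) : ℝ := min (s / ε) 1

/-- The derivative of `pairKernel ε s w` in `s`, for `0 ≤ s ≤ w`. -/
def kernelSlope (ε s w : ℝ) : ℝ := if |w - 2 * ε| < s then 1 / (2 * ε) else 0

lemma tent_nonneg (ε x : ℝ) : 0 ≤ tent ε x := le_max_left _ _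

lemma tent_le_one {ε : ℝ} (hε : 0 < ε) (x : ℝ) : tent ε x ≤ 1 :=
  max_le zero_le_one (by have : 0 ≤ |x| / (2 * ε) := by positivity
                         linarith)

lemma tent_neg (ε x : ℝ) : tent ε (-x) = tent ε x := by simp [tent]

@[fun_prop]
lemma continuous_tent (ε : ℝ) : Continuous (tent ε) := by unfold tent; fun_prop

lemma tent_two_mul {ε s : ℝ} (hε : 0 < ε) (hs : 0 ≤ s) : tent ε (2 * s) = 1 - ramp ε s := by
  have : |2 * s| / (2 * ε) = s / ε := by
    rw [abs_of_nonneg (by positivity)]; field_simp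
  rw [tent, ramp, this]
  rcases le_total (s / ε) 1 with h | h
  · rw [min_eq_left h, max_eq_right (by linarith)]
  · rw [min_eq_right h, max_eq_left (by linarith)]; ring

lemma pairKernel_nonneg (ε a w : ℝ) : 0 ≤ pairKernel ε a w :=
  add_nonneg (tent_nonneg _ _) (tent_nonneg _ _)

lemma pairKernel_le_two {ε : ℝ} (hε : 0 < ε) (a w : ℝ) : pairKernel ε a w ≤ 2 := by
  have := tent_le_one hε (a - w)
  have := tent_le_one hε (a + w)
  unfold pairKernel; linarith

lemma pairKernel_comm (ε a w : ℝ) : pairKernel ε a w = pairKernel ε w a := by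
  rw [pairKernel, pairKernel, ← tent_neg ε (a - w), neg_sub, add_comm a w]

@[fun_prop]
lemma continuous_pairKernel (ε : ℝ) : Continuous fun x : ℝ × ℝ => pairKernel ε x.1 x.2 := by
  unfold pairKernel; fun_prop

lemma pairKernel_self {ε a : ℝ} (hε : 0 < ε) (ha : 0 ≤ a) :
    pairKernel ε a a = 2 - ramp ε a := by
  rw [pairKernel, ← two_mul, tent_two_mul hε ha]
  simp [tent]; ring

@[fun_prop]
lemma continuous_ramp (ε : ℝ) : Continuous (ramp ε) := by unfold ramp; fun_prop

lemma ramp_nonneg {ε s : ℝ} (hε : 0 < ε) (hs : 0 ≤ s) : 0 ≤ ramp ε s :=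
  le_min (by positivity) zero_le_one

lemma ramp_le_one (ε s : ℝ) : ramp ε s ≤ 1 := min_le_right _ _

lemma ramp_mono {ε : ℝ} (hε : 0 < ε) : Monotone (ramp ε) := fun a b h =>
  min_le_min_right _ (by gcongr)

lemma ramp_of_le {ε s : ℝ} (hε : 0 < ε) (hs : s ≤ ε) : ramp ε s = s / ε :=
  min_eq_left ((div_le_one hε).2 hs)

lemma ramp_of_ge {ε s : ℝ} (hε : 0 < ε) (hs : ε ≤ s) : ramp ε s = 1 :=
  min_eq_right ((one_le_div hε).2 hs)

/-- The arguments a - w and a + w sweep [0, a] and [a, 2a], so the two tents join into one integral.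
-/
lemma kernelMass_eq_integral_tent (ε a : ℝ) :
    kernelMass ε a = ∫ x in (0 : ℝ)..2 * a, tent ε x := by
  have hi : ∀ u v, IntervalIntegrable (tent ε) volume u v :=
    fun u v => (continuous_tent ε).intervalIntegrable _ _
  unfold kernelMass pairKernel
  rw [intervalIntegral.integral_add (Continuous.intervalIntegrable (by fun_prop) _ _)
    (Continuous.intervalIntegrable (by fun_prop) _ _),
    intervalIntegral.integral_comp_sub_left (tent ε), intervalIntegral.integral_comp_add_left
    (tent ε), sub_self, sub_zero, add_zero,
    intervalIntegral.integral_add_adjacent_intervals (hi _ _) (hi _ _), two_mul]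

lemma kernelMass_eq_integral_ramp {ε a : ℝ} (hε : 0 < ε) (ha : 0 ≤ a) :
    kernelMass ε a = ∫ t in (0 : ℝ)..a, 2 * (1 - ramp ε t) := by
  have h : ∫ t in (0 : ℝ)..a, 2 * (1 - ramp ε t) = ∫ t in (0 : ℝ)..a, 2 * tent ε (2 * t) := by
    refine intervalIntegral.integral_congr fun t ht => ?_
    rw [Set.uIcc_of_le ha] at ht
    simp only [tent_two_mul hε ht.1]
  rw [h, intervalIntegral.integral_const_mul, intervalIntegral.integral_comp_mul_left (tent ε)
    two_ne_zero, kernelMass_eq_integral_tent]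
  simp

lemma kernelMass_of_le {ε a : ℝ} (hε : 0 < ε) (ha : 0 ≤ a) (h : a ≤ ε) :
    kernelMass ε a = 2 * a - a ^ 2 / ε := by
  have : ∫ t in (0 : ℝ)..a, 2 * (1 - ramp ε t) = ∫ t in (0 : ℝ)..a, (2 - (2 / ε) * t) := by
    refine intervalIntegral.integral_congr fun t ht => ?_
    rw [Set.uIcc_of_le ha] at ht
    simp only [ramp_of_le hε (ht.2.trans h)]; ring
  rw [kernelMass_eq_integral_ramp hε ha, this, intervalIntegral.integral_sub (by simp)
    (Continuous.intervalIntegrable (by fun_prop) _ _), intervalIntegral.integral_const_mul]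
  simp
  field_simp

lemma kernelMass_of_ge {ε a : ℝ} (hε : 0 < ε) (h : ε ≤ a) : kernelMass ε a = ε := by
  have hc : ∀ u v, IntervalIntegrable (fun t => 2 * (1 - ramp ε t)) volume u v :=
    fun u v => Continuous.intervalIntegrable (by fun_prop) _ _
  have : ∫ t in ε..a, 2 * (1 - ramp ε t) = ∫ t in ε..a, 0 := by
    refine intervalIntegral.integral_congr fun t ht => ?_
    rw [Set.uIcc_of_le h] at ht
    simp [ramp_of_ge hε ht.1]
  rw [kernelMass_eq_integral_ramp hε (hε.le.trans h),
    ← intervalIntegral.integral_add_adjacent_intervals (hc 0 ε) (hc ε a),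
    ← kernelMass_eq_integral_ramp hε hε.le, kernelMass_of_le hε hε.le le_rfl, this]
  simp
  field_simp; ring

lemma hasDerivAt_kernelMass {ε a : ℝ} (hε : 0 < ε) (ha : 0 < a) :
    HasDerivAt (kernelMass ε) (2 * (1 - ramp ε a)) a := by
  have hc : Continuous fun t => 2 * (1 - ramp ε t) := by fun_prop
  have := (hc.integral_hasStrictDerivAt 0 a).hasDerivAt
  refine this.congr_of_eventuallyEq ?_
  filter_upwards [lt_mem_nhds ha] with x hx using kernelMass_eq_integral_ramp hε hx.le

@[fun_prop]
lemma continuous_kernelMass (ε : ℝ) : Continuous (kernelMass ε) := by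
  have : kernelMass ε = fun a => ∫ x in (0 : ℝ)..2 * a, tent ε x :=
    funext fun a => kernelMass_eq_integral_tent ε a
  rw [this]
  exact (intervalIntegral.continuous_primitive
    (fun u v => (continuous_tent ε).intervalIntegrable u v) 0).comp (by fun_prop)

lemma kernelMass_mono {ε a b : ℝ} (ha : 0 ≤ a) (h : a ≤ b) :
    kernelMass ε a ≤ kernelMass ε b := by
  rw [kernelMass_eq_integral_tent, kernelMass_eq_integral_tent]
  exact intervalIntegral.integral_mono_interval le_rfl (by linarith) (by linarith)
    (Filter.Eventually.of_forall (tent_nonneg ε)) ((continuous_tent ε).intervalIntegrable _ _)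

lemma kernelMass_pos {ε a : ℝ} (hε : 0 < ε) (ha : 0 < a) : 0 < kernelMass ε a := by
  rcases le_total a ε with h | h
  · rw [kernelMass_of_le hε ha.le h]
    have : a ^ 2 / ε ≤ a := by rw [div_le_iff₀ hε]; nlinarith
    linarith
  · rwa [kernelMass_of_ge hε h]

lemma integral_kernelMass {ε : ℝ} (hε : 0 < ε) (hε1 : ε < 1) :
    ∫ a in (0 : ℝ)..1, kernelMass ε a = ε - ε ^ 2 / 3 := by
  have hc : ∀ u v, IntervalIntegrable (kernelMass ε) volume u v :=
    fun u v => Continuous.intervalIntegrable (by fun_prop) _ _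
  rw [← intervalIntegral.integral_add_adjacent_intervals (hc 0 ε) (hc ε 1)]
  have h1 : ∫ a in (0 : ℝ)..ε, kernelMass ε a = ∫ a in (0 : ℝ)..ε, (2 * a - (1 / ε) * a ^ 2) := by
    refine intervalIntegral.integral_congr fun t ht => ?_
    rw [Set.uIcc_of_le hε.le] at ht
    simp only [kernelMass_of_le hε ht.1 ht.2]; ring
  have h2 : ∫ a in ε..1, kernelMass ε a = ∫ a in ε..1, ε := by
    refine intervalIntegral.integral_congr fun t ht => ?_
    rw [Set.uIcc_of_le hε1.le] at ht
    simp only [kernelMass_of_ge hε ht.1]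
  rw [h1, h2, intervalIntegral.integral_sub (Continuous.intervalIntegrable (by fun_prop) _ _)
    (Continuous.intervalIntegrable (by fun_prop) _ _), intervalIntegral.integral_const_mul,
    intervalIntegral.integral_const_mul]
  simp
  field_simp; ring

/-! ### The slope of the kernel and integration over triangles -/

lemma measurable_kernelSlope (ε : ℝ) :
    Measurable fun x : ℝ × ℝ => kernelSlope ε x.1 x.2 := by
  unfold kernelSlope
  exact Measurable.ite (measurableSet_lt (by fun_prop) (by fun_prop)) measurable_const
    measurable_const

lemma integral_ite_lt_const {a b c y : ℝ} (hab : a ≤ b) :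
    ∫ s in a..b, (if c < s then y else 0) = y * (max 0 (b - c) - max 0 (a - c)) := by
  have hi : ∀ s, (if c < s then y else 0) = (Set.Ioi c).indicator (fun _ => y) s := by
    intro s; simp [Set.indicator]
  simp only [hi]
  rw [intervalIntegral.integral_of_le hab, setIntegral_indicator measurableSet_Ioi,
    Set.Ioc_inter_Ioi, setIntegral_const, measureReal_def, Real.volume_Ioc, smul_eq_mul, mul_comm,
    ENNReal.toReal_ofReal']
  congr 1
  rcases le_total a c with h | h <;> rcases le_total b c with h' | h' <;>
    simp only [max_def] <;> split_ifs <;> linarith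

lemma integral_kernelSlope {ε a w : ℝ} (hε : 0 < ε) (ha : 0 ≤ a) (h : a ≤ w) :
    ∫ s in a..w, kernelSlope ε s w = pairKernel ε w w - pairKernel ε a w := by
  unfold kernelSlope
  rw [integral_ite_lt_const h]
  -- For s ≤ w the two tents have arguments w - s and w + s. Their slopes in s cancel except where
  -- exactly one tent is positive or, equivalently here, s exceeds |w - 2ε|.
  have hk : ∀ s, 0 ≤ s → s ≤ w → pairKernel ε s w =
      2 * tent ε w + 1 / (2 * ε) * max 0 (s - |w - 2 * ε|) := by
    intro s hs hsw
    have key : ∀ x, 0 ≤ x → tent ε x = 1 / (2 * ε) * max 0 (2 * ε - x) := by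
      intro x hx
      have h1 : 1 - x / (2 * ε) = 1 / (2 * ε) * (2 * ε - x) := by field_simp
      rw [tent, abs_of_nonneg hx, mul_max_of_nonneg _ _ (by positivity), mul_zero, h1]
    rw [pairKernel, ← tent_neg, neg_sub, key _ (by linarith), key _ (by linarith),
      key w (by linarith)]
    rw [← mul_add, mul_left_comm, ← mul_add]
    congr 1
    rcases le_total w (2 * ε) with h1 | h1
    · rw [abs_of_nonpos (by linarith)]
      simp only [max_def]; split_ifs <;> linarith
    · rw [abs_of_nonneg (by linarith)]
      simp only [max_def]; split_ifs <;> linarith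
  rw [hk w (ha.trans h) le_rfl, hk a ha h]
  ring

/-- Exchanging the order of integration over a triangle. -/
lemma integral_integral_triangle {F : ℝ → ℝ → ℝ} {C a b : ℝ}
    (hF : Measurable fun x : ℝ × ℝ => F x.1 x.2) (hC : ∀ s w, |F s w| ≤ C) (hab : a ≤ b) :
    ∫ s in a..b, ∫ w in s..b, F s w = ∫ w in a..b, ∫ s in a..w, F s w := by
  set G : ℝ → ℝ → ℝ := fun s w => if s < w then F s w else 0
  have hG : Measurable fun x : ℝ × ℝ => G x.1 x.2 :=
    Measurable.ite (measurableSet_lt measurable_fst measurable_snd) hF measurable_const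
  have h1 : ∫ s in a..b, ∫ w in s..b, F s w =
      ∫ s in Set.Ioc a b, ∫ w in Set.Ioc a b, G s w := by
    rw [intervalIntegral.integral_of_le hab]
    refine setIntegral_congr_fun measurableSet_Ioc fun s hs => ?_
    have : ∀ w, G s w = (Set.Ioi s).indicator (fun w => F s w) w := by
      intro w; simp [G, Set.indicator]
    simp only [this]
    rw [intervalIntegral.integral_of_le hs.2, setIntegral_indicator measurableSet_Ioi,
      Set.Ioc_inter_Ioi, sup_eq_right.2 hs.1.le]
  have h2 : ∫ w in a..b, ∫ s in a..w, F s w =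
      ∫ w in Set.Ioc a b, ∫ s in Set.Ioc a b, G s w := by
    rw [intervalIntegral.integral_of_le hab]
    refine setIntegral_congr_fun measurableSet_Ioc fun w hw => ?_
    have : ∀ s, G s w = (Set.Iio w).indicator (fun s => F s w) s := by
      intro s; simp [G, Set.indicator]
    simp only [this]
    -- The cut s < w is strict, so the half-open interval must lose its right endpoint, a null set.
    rw [intervalIntegral.integral_of_le hw.1.le, setIntegral_indicator measurableSet_Iio,
      integral_Ioc_eq_integral_Ioo]
    congr 2
    ext s
    simp only [Set.mem_Ioo, Set.mem_inter_iff, Set.mem_Ioc, Set.mem_Iio]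
    exact ⟨fun h => ⟨⟨h.1, h.2.le.trans hw.2⟩, h.2⟩, fun h => ⟨h.1.1, h.2⟩⟩
  rw [h1, h2]
  refine integral_integral_swap ?_
  refine Integrable.of_bound (C := |C|) hG.aestronglyMeasurable ?_
  refine Filter.Eventually.of_forall fun x => ?_
  simp only [Function.uncurry, G]
  split_ifs
  · exact (hC _ _).trans (le_abs_self C)
  · simp

/-! ### The value equation and uniqueness -/

/-- Twice the payoff of a quack who sends a message of magnitude `a` when the judge follows the
max rule `g`. -/
def maxRuleValue (ε : ℝ) (g : ℝ → ℝ) (a : ℝ) : ℝ :=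
  g a * kernelMass ε a + ∫ w in a..1, (1 - g w) * pairKernel ε a w

lemma intervalIntegrable_of_bound {F : ℝ → ℝ} {C : ℝ} (hF : Measurable F) (hC : ∀ x, |F x| ≤ C)
    (a b : ℝ) : IntervalIntegrable F volume a b :=
  (intervalIntegrable_const (c := C)).mono_fun hF.aestronglyMeasurable
    (Filter.Eventually.of_forall fun x => (hC x).trans (le_abs_self C))

/-- After exchanging the order, symmetry of the kernel turns the inner integral over a ≤ w into
`kernelMass ε w`. This is what makes the rule cancel from the averaged value. -/
lemma integral_mul_pairKernel {ε C : ℝ} (hε : 0 < ε) {h : ℝ → ℝ} (hm : Measurable h)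
    (hb : ∀ x, |h x| ≤ C) :
    ∫ a in (0 : ℝ)..1, ∫ w in a..1, h w * pairKernel ε a w =
      ∫ w in (0 : ℝ)..1, h w * kernelMass ε w := by
  rw [integral_integral_triangle (C := C * 2) _ _ zero_le_one]
  · refine intervalIntegral.integral_congr fun w _ => ?_
    simp only [intervalIntegral.integral_const_mul, kernelMass, pairKernel_comm ε w]
  · exact (hm.comp measurable_snd).mul (continuous_pairKernel ε).measurable
  · intro s w
    rw [abs_mul, abs_of_nonneg (pairKernel_nonneg _ _ _)]
    exact mul_le_mul (hb w) (pairKernel_le_two hε _ _) (pairKernel_nonneg _ _ _)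
      ((abs_nonneg _).trans (hb w))

/-- If the value is the same at all magnitudes, it is determined by `ε`. -/
lemma maxRuleValue_eq_of_const {ε c C : ℝ} (hε : 0 < ε) (hε1 : ε < 1) {g : ℝ → ℝ}
    (hm : Measurable g) (hb : ∀ x, |g x| ≤ C)
    (h : ∀ a ∈ Set.Ioc (0 : ℝ) 1, maxRuleValue ε g a = c) : c = ε - ε ^ 2 / 3 := by
  have hS : Continuous (kernelMass ε) := continuous_kernelMass ε
  have hg : IntervalIntegrable (fun a => g a * kernelMass ε a) volume 0 1 :=
    (intervalIntegrable_of_bound hm hb 0 1).mul_continuousOn hS.continuousOn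
  have hb' : ∀ x, |1 - g x| ≤ 1 + C := fun x =>
    (abs_sub _ _).trans (by rw [abs_one]; linarith [hb x])
  have h1 : ∫ a in (0 : ℝ)..1, (c - g a * kernelMass ε a) =
      ∫ a in (0 : ℝ)..1, ∫ w in a..1, (1 - g w) * pairKernel ε a w := by
    rw [intervalIntegral.integral_of_le zero_le_one, intervalIntegral.integral_of_le zero_le_one]
    refine setIntegral_congr_fun measurableSet_Ioc fun a ha => ?_
    rw [← h a ha, maxRuleValue]; ring
  rw [integral_mul_pairKernel (h := fun x => 1 - g x) hε (measurable_const.sub hm) hb',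
    intervalIntegral.integral_sub (by simp) hg] at h1
  have h2 : ∫ a in (0 : ℝ)..1, (1 - g a) * kernelMass ε a =
      (∫ a in (0 : ℝ)..1, kernelMass ε a) - ∫ a in (0 : ℝ)..1, g a * kernelMass ε a := by
    rw [← intervalIntegral.integral_sub (hS.intervalIntegrable _ _) hg]
    refine intervalIntegral.integral_congr fun a _ => ?_
    ring
  rw [h2, integral_kernelMass hε hε1] at h1
  simp at h1
  linarith

/-- On [a₀, 1] the mass is at least σ > 0, so the equation is a regular Volterra equation. In the
norm weighted by exp(4(1 - a)/σ) its operator contracts by 1/2: the kernel bound 2, division by σ,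
and the factor σ/4 from integrating the exponential multiply to 1/2. Iterating sends the bound on d
to 0. -/
lemma eq_zero_of_mul_kernelMass_eq {ε C : ℝ} (hε : 0 < ε) {d : ℝ → ℝ} (hb : ∀ x, |d x| ≤ C)
    (h : ∀ a ∈ Set.Ioc (0 : ℝ) 1, d a * kernelMass ε a = ∫ w in a..1, d w * pairKernel ε a w)
    {a₀ : ℝ} (ha₀ : a₀ ∈ Set.Ioc (0 : ℝ) 1) : d a₀ = 0 := by
  set σ := kernelMass ε a₀
  have hσ : 0 < σ := kernelMass_pos hε ha₀.1
  have hC : 0 ≤ C := (abs_nonneg _).trans (hb 0)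
  have key : ∀ n : ℕ, ∀ a ∈ Set.Icc a₀ 1,
      |d a| ≤ C * (1 / 2) ^ n * Real.exp (4 / σ * (1 - a)) := by
    intro n
    induction n with
    | zero =>
      intro a ha
      have : 1 ≤ Real.exp (4 / σ * (1 - a)) :=
        Real.one_le_exp (mul_nonneg (by positivity) (by linarith [ha.2]))
      simpa using (hb a).trans (le_mul_of_one_le_right hC this)
    | succ n ih =>
      intro a ha
      have hS : σ ≤ kernelMass ε a := kernelMass_mono ha₀.1.le ha.1
      have h1 := h a ⟨ha₀.1.trans_le ha.1, ha.2⟩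
      have hexp : ∫ w in a..1, Real.exp (4 / σ * (1 - w)) =
          (Real.exp (4 / σ * (1 - a)) - 1) / (4 / σ) := by
        have hd : ∀ w ∈ Set.uIcc a 1, HasDerivAt
            (fun w => -(Real.exp (4 / σ * (1 - w)) / (4 / σ))) (Real.exp (4 / σ * (1 - w))) w := by
          intro w _
          have := ((((hasDerivAt_id w).const_sub 1).const_mul (4 / σ)).exp.div_const (4 / σ)).neg
          refine this.congr_deriv ?_
          simp; field_simp
        rw [intervalIntegral.integral_eq_sub_of_hasDerivAt hd
          (Continuous.intervalIntegrable (by fun_prop) _ _)]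
        simp only [sub_self, mul_zero, Real.exp_zero]; ring
      have h2 : |∫ w in a..1, d w * pairKernel ε a w| ≤
          ∫ w in a..1, 2 * (C * (1 / 2) ^ n) * Real.exp (4 / σ * (1 - w)) := by
        have := intervalIntegral.norm_integral_le_of_norm_le (a := a) (b := 1) (μ := volume)
          (f := fun w => d w * pairKernel ε a w)
          (g := fun w => 2 * (C * (1 / 2) ^ n) * Real.exp (4 / σ * (1 - w))) ha.2
          (Filter.Eventually.of_forall fun w hw => ?_)
          (Continuous.intervalIntegrable (by fun_prop) _ _)
        · exact this
        · rw [Real.norm_eq_abs, abs_mul, abs_of_nonneg (pairKernel_nonneg _ _ _), mul_assoc,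
            mul_comm]
          exact mul_le_mul (pairKernel_le_two hε _ _) (ih w ⟨ha.1.trans hw.1.le, hw.2⟩)
            (abs_nonneg _) zero_le_two
      rw [intervalIntegral.integral_const_mul, hexp, ← h1, abs_mul,
        abs_of_nonneg (hσ.le.trans hS)] at h2
      have h3 : |d a| * σ ≤ C * (1 / 2) ^ (n + 1) * Real.exp (4 / σ * (1 - a)) * σ := by
        refine (mul_le_mul_of_nonneg_left hS (abs_nonneg _)).trans (h2.trans ?_)
        have : (Real.exp (4 / σ * (1 - a)) - 1) / (4 / σ) ≤ Real.exp (4 / σ * (1 - a)) * σ / 4 := by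
          have : (Real.exp (4 / σ * (1 - a)) - 1) / (4 / σ) =
            Real.exp (4 / σ * (1 - a)) * σ / 4 - σ / 4 := by field_simp
          rw [this]; linarith
        calc _ ≤ 2 * (C * (1 / 2) ^ n) * (Real.exp (4 / σ * (1 - a)) * σ / 4) := by gcongr
          _ = _ := by ring
      exact le_of_mul_le_mul_right h3 hσ
  have hlim : Filter.Tendsto (fun n : ℕ => C * (1 / 2 : ℝ) ^ n * Real.exp (4 / σ * (1 - a₀)))
      Filter.atTop (nhds 0) := by
    have := ((tendsto_pow_atTop_nhds_zero_of_lt_one (r := (1 / 2 : ℝ)) (by norm_num)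
      (by norm_num)).const_mul C).mul_const (Real.exp (4 / σ * (1 - a₀)))
    simpa using this
  have := ge_of_tendsto' hlim fun n => key n a₀ ⟨le_rfl, ha₀.2⟩
  exact abs_eq_zero.1 (le_antisymm this (abs_nonneg _))

/-- Two measurable max rules under which the quack is indifferent agree at positive magnitudes. -/
lemma eq_of_maxRuleValue_const {ε c c' C : ℝ} (hε : 0 < ε) (hε1 : ε < 1) {f g : ℝ → ℝ}
    (hf : Measurable f) (hg : Measurable g) (hfb : ∀ x, |f x| ≤ C) (hgb : ∀ x, |g x| ≤ C)
    (hfc : ∀ a ∈ Set.Ioc (0 : ℝ) 1, maxRuleValue ε f a = c)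
    (hgc : ∀ a ∈ Set.Ioc (0 : ℝ) 1, maxRuleValue ε g a = c')
    {a : ℝ} (ha : a ∈ Set.Ioc (0 : ℝ) 1) : g a = f a := by
  have hcc : c = c' := by
    rw [maxRuleValue_eq_of_const hε hε1 hf hfb hfc, maxRuleValue_eq_of_const hε hε1 hg hgb hgc]
  have hcont : ∀ a, Continuous fun w => pairKernel ε a w := fun a => by
    exact (continuous_pairKernel ε).comp (by fun_prop : Continuous fun w : ℝ => (a, w))
  have hint : ∀ {u : ℝ → ℝ}, Measurable u → (∀ x, |u x| ≤ C) → ∀ a,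
      IntervalIntegrable (fun w => (1 - u w) * pairKernel ε a w) volume a 1 := fun hu hb a =>
    (intervalIntegrable_const.sub (intervalIntegrable_of_bound hu hb a 1)).mul_continuousOn
      (hcont a).continuousOn
  refine sub_eq_zero.1 (eq_zero_of_mul_kernelMass_eq (d := fun x => g x - f x) (C := C + C) hε
    (fun x => (abs_sub _ _).trans (add_le_add (hgb x) (hfb x))) ?_ ha)
  intro b hb
  have h1 : (∫ w in b..1, (g w - f w) * pairKernel ε b w) =
      (∫ w in b..1, (1 - f w) * pairKernel ε b w) -
        ∫ w in b..1, (1 - g w) * pairKernel ε b w := by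
    rw [← intervalIntegral.integral_sub (hint hf hfb b) (hint hg hgb b)]
    refine intervalIntegral.integral_congr fun w _ => ?_
    ring
  have h2 := hfc b hb
  have h3 := hgc b hb
  simp only [maxRuleValue] at h2 h3
  rw [h1]
  linarith

/-! ### The averaging operator and its fixed point -/

/-- The function `k`, replaced by `1` on `[1, ∞)`. -/
def capped (k : ℝ → unitInterval) (w : ℝ) : ℝ := if w < 1 then (k w : ℝ) else 1

lemma capped_nonneg (k : ℝ → unitInterval) (w : ℝ) : 0 ≤ capped k w := by
  unfold capped; split_ifs
  exacts [(k w).2.1, zero_le_one]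

lemma capped_le_one (k : ℝ → unitInterval) (w : ℝ) : capped k w ≤ 1 := by
  unfold capped; split_ifs
  exacts [(k w).2.2, le_rfl]

lemma le_capped (k : ℝ → unitInterval) (w : ℝ) : (k w : ℝ) ≤ capped k w := by
  unfold capped; split_ifs
  exacts [le_rfl, (k w).2.2]

lemma capped_monotone (k : ℝ →o unitInterval) : Monotone (capped k) := by
  intro a b h
  unfold capped; split_ifs with h1 h2 h2
  exacts [k.monotone h, (k a).2.2, absurd (h.trans_lt h2) h1, le_rfl]

lemma capped_mono_left {k l : ℝ →o unitInterval} (h : k ≤ l) (w : ℝ) :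
    capped k w ≤ capped l w := by
  unfold capped; split_ifs
  exacts [h w, le_rfl]

lemma intervalIntegrable_capped (k : ℝ →o unitInterval) (a b : ℝ) :
    IntervalIntegrable (capped k) volume a b :=
  (capped_monotone k).intervalIntegrable

/-- The integral of `capped k` over the window on which `kernelSlope ε s` is positive,
divided by `2 * ε`. -/
def windowMean (ε : ℝ) (k : ℝ → unitInterval) (s : ℝ) : ℝ :=
  1 / (2 * ε) * ∫ w in max s (2 * ε - s)..2 * ε + s, capped k w

@[fun_prop]
lemma continuous_windowMean (ε : ℝ) (k : ℝ →o unitInterval) : Continuous (windowMean ε k) := by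
  have hp : Continuous fun a => ∫ w in (0 : ℝ)..a, capped k w :=
    intervalIntegral.continuous_primitive (intervalIntegrable_capped k) 0
  have : windowMean ε k = fun s => 1 / (2 * ε) * ((∫ w in (0 : ℝ)..2 * ε + s, capped k w) -
      ∫ w in (0 : ℝ)..max s (2 * ε - s), capped k w) := by
    funext s
    rw [windowMean, intervalIntegral.integral_interval_sub_left] <;>
      exact intervalIntegrable_capped _ _ _
  rw [this]
  exact continuous_const.mul ((hp.comp (by fun_prop)).sub (hp.comp (by fun_prop)))

/-- Measuring from the upper end of the window puts s into a monotone integrand and an increasing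
length, which makes monotonicity in s visible. -/
lemma windowMean_eq (ε : ℝ) (k : ℝ → unitInterval) (s : ℝ) :
    windowMean ε k s =
      1 / (2 * ε) * ∫ x in (0 : ℝ)..min (2 * s) (2 * ε), capped k (2 * ε + s - x) := by
  rw [windowMean, intervalIntegral.integral_comp_sub_left, sub_zero]
  congr 3
  rcases le_total s ε with h | h
  · rw [min_eq_left (by linarith), max_eq_right (by linarith)]; ring
  · rw [min_eq_right (by linarith), max_eq_left (by linarith)]; ring

lemma intervalIntegrable_capped_sub (k : ℝ →o unitInterval) (c a b : ℝ) :
    IntervalIntegrable (fun x => capped k (c - x)) volume a b :=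
  Antitone.intervalIntegrable fun _ _ h => capped_monotone k (by linarith)

lemma windowMean_nonneg {ε s : ℝ} (hε : 0 < ε) (k : ℝ → unitInterval) (hs : 0 ≤ s) :
    0 ≤ windowMean ε k s := by
  rw [windowMean_eq]
  exact mul_nonneg (by positivity)
    (intervalIntegral.integral_nonneg (by positivity) fun x _ => capped_nonneg _ _)

lemma windowMean_le_ramp {ε s : ℝ} (hε : 0 < ε) (k : ℝ →o unitInterval) (hs : 0 ≤ s) :
    windowMean ε k s ≤ ramp ε s := by
  have h0 : 0 ≤ min (2 * s) (2 * ε) := by positivity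
  have h1 : ∫ x in (0 : ℝ)..min (2 * s) (2 * ε), capped k (2 * ε + s - x) ≤
      min (2 * s) (2 * ε) := by
    have := intervalIntegral.integral_mono_on h0
      (intervalIntegrable_capped_sub k (2 * ε + s) _ _)
      (intervalIntegrable_const (c := (1 : ℝ))) fun x _ => capped_le_one k _
    simpa using this
  have h2 : ramp ε s = 1 / (2 * ε) * min (2 * s) (2 * ε) := by
    rw [mul_min_of_nonneg _ _ (by positivity), ramp]
    congr 1 <;> field_simp
  rw [windowMean_eq, h2]
  gcongr

lemma windowMean_mono {ε s t : ℝ} (hε : 0 < ε) (k : ℝ →o unitInterval) (hs : 0 ≤ s)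
    (hst : s ≤ t) : windowMean ε k s ≤ windowMean ε k t := by
  rw [windowMean_eq, windowMean_eq]
  have h0 : 0 ≤ min (2 * s) (2 * ε) := by positivity
  have : ∫ x in (0 : ℝ)..min (2 * s) (2 * ε), capped k (2 * ε + s - x) ≤
      ∫ x in (0 : ℝ)..min (2 * t) (2 * ε), capped k (2 * ε + t - x) := by
    refine (intervalIntegral.integral_mono_on h0 (intervalIntegrable_capped_sub _ _ _ _)
      (intervalIntegrable_capped_sub k (2 * ε + t) _ _)
      fun x _ => capped_monotone k (by linarith)).trans ?_
    exact intervalIntegral.integral_mono_interval le_rfl h0 (by gcongr)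
      (Filter.Eventually.of_forall fun x => capped_nonneg _ _)
      (intervalIntegrable_capped_sub _ _ _ _)
  gcongr

lemma windowMean_mono_left {ε s : ℝ} (hε : 0 < ε) {k l : ℝ →o unitInterval} (h : k ≤ l)
    (hs : 0 ≤ s) : windowMean ε k s ≤ windowMean ε l s := by
  rw [windowMean_eq, windowMean_eq]
  have := intervalIntegral.integral_mono_on (by positivity : 0 ≤ min (2 * s) (2 * ε))
    (intervalIntegrable_capped_sub k (2 * ε + s) _ _)
    (intervalIntegrable_capped_sub l (2 * ε + s) _ _) fun x _ => capped_mono_left h _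
  gcongr

/-- The factor that turns `kernelMass ε * k' + (4 - 3 * ramp ε) * k` into a total derivative. -/
def integratingFactor (ε s : ℝ) : ℝ := if s ≤ ε then s else ε * Real.exp ((s - ε) / ε)

@[fun_prop]
lemma continuous_integratingFactor (ε : ℝ) : Continuous (integratingFactor ε) := by
  unfold integratingFactor
  exact Continuous.if_le (by fun_prop) (by fun_prop) (by fun_prop) (by fun_prop)
    (by rintro x rfl; simp)

lemma integratingFactor_pos {ε s : ℝ} (hε : 0 < ε) (hs : 0 < s) : 0 < integratingFactor ε s := by
  unfold integratingFactor; split_ifs <;> positivity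

lemma integratingFactor_nonneg {ε s : ℝ} (hε : 0 < ε) (hs : 0 ≤ s) :
    0 ≤ integratingFactor ε s := by
  unfold integratingFactor; split_ifs <;> positivity

/-- The density of the weights in the averaging operator. -/
def avgDensity (ε s : ℝ) : ℝ := integratingFactor ε s * (4 - 3 * ramp ε s)

/-- The total weight of `[0, a]` in the averaging operator. -/
def avgWeight (ε a : ℝ) : ℝ := ∫ s in (0 : ℝ)..a, avgDensity ε s

/-- The unnormalized average over `[0, a]` in the averaging operator. -/
def avgNumerator (ε : ℝ) (k : ℝ → unitInterval) (a : ℝ) : ℝ :=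
  ∫ s in (0 : ℝ)..a, integratingFactor ε s * windowMean ε k s

@[fun_prop]
lemma continuous_avgDensity (ε : ℝ) : Continuous (avgDensity ε) := by
  unfold avgDensity; fun_prop

lemma avgDensity_pos {ε s : ℝ} (hε : 0 < ε) (hs : 0 < s) : 0 < avgDensity ε s :=
  mul_pos (integratingFactor_pos hε hs) (by linarith [ramp_le_one ε s])

lemma hasDerivAt_avgWeight (ε a : ℝ) : HasDerivAt (avgWeight ε) (avgDensity ε a) a :=
  ((continuous_avgDensity ε).integral_hasStrictDerivAt 0 a).hasDerivAt

lemma hasDerivAt_avgNumerator (ε : ℝ) (k : ℝ →o unitInterval) (a : ℝ) :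
    HasDerivAt (avgNumerator ε k) (integratingFactor ε a * windowMean ε k a) a :=
  ((by fun_prop : Continuous fun s => integratingFactor ε s *
    windowMean ε k s).integral_hasStrictDerivAt 0 a).hasDerivAt

lemma avgWeight_pos {ε a : ℝ} (hε : 0 < ε) (ha : 0 < a) : 0 < avgWeight ε a :=
  intervalIntegral.intervalIntegral_pos_of_pos_on ((continuous_avgDensity ε).intervalIntegrable _ _)
    (fun _ hx => avgDensity_pos hε hx.1) ha

lemma avgWeight_sub (ε a b : ℝ) :
    avgWeight ε b - avgWeight ε a = ∫ s in a..b, avgDensity ε s :=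
  intervalIntegral.integral_interval_sub_left ((continuous_avgDensity ε).intervalIntegrable _ _)
    ((continuous_avgDensity ε).intervalIntegrable _ _)

lemma intervalIntegrable_avgNumerator (ε : ℝ) (k : ℝ →o unitInterval) (a b : ℝ) :
    IntervalIntegrable (fun s => integratingFactor ε s * windowMean ε k s) volume a b :=
  Continuous.intervalIntegrable (by fun_prop) _ _

lemma avgNumerator_sub (ε : ℝ) (k : ℝ →o unitInterval) (a b : ℝ) :
    avgNumerator ε k b - avgNumerator ε k a =
      ∫ s in a..b, integratingFactor ε s * windowMean ε k s :=
  intervalIntegral.integral_interval_sub_left (intervalIntegrable_avgNumerator _ _ _ _)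
    (intervalIntegrable_avgNumerator _ _ _ _)

lemma avgNumerator_nonneg {ε a : ℝ} (hε : 0 < ε) (k : ℝ → unitInterval) (ha : 0 ≤ a) :
    0 ≤ avgNumerator ε k a :=
  intervalIntegral.integral_nonneg ha fun _ hs =>
    mul_nonneg (integratingFactor_nonneg hε hs.1) (windowMean_nonneg hε k hs.1)

lemma avgNumerator_sub_le {ε a b c : ℝ} (hε : 0 < ε) (k : ℝ →o unitInterval)
    (ha : 0 ≤ a) (hab : a ≤ b) (h : ∀ s ∈ Set.Icc a b, windowMean ε k s ≤ c * (4 - 3 * ramp ε s)) :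
    avgNumerator ε k b - avgNumerator ε k a ≤ c * (avgWeight ε b - avgWeight ε a) := by
  rw [avgNumerator_sub, avgWeight_sub, ← intervalIntegral.integral_const_mul]
  refine intervalIntegral.integral_mono_on hab (intervalIntegrable_avgNumerator _ _ _ _)
    (Continuous.intervalIntegrable (by fun_prop) _ _) fun s hs => ?_
  have := mul_le_mul_of_nonneg_left (h s hs) (integratingFactor_nonneg hε (ha.trans hs.1))
  rw [avgDensity]; linarith

lemma le_avgNumerator_sub {ε a b c : ℝ} (hε : 0 < ε) (k : ℝ →o unitInterval)
    (ha : 0 ≤ a) (hab : a ≤ b) (h : ∀ s ∈ Set.Icc a b, c * (4 - 3 * ramp ε s) ≤ windowMean ε k s) :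
    c * (avgWeight ε b - avgWeight ε a) ≤ avgNumerator ε k b - avgNumerator ε k a := by
  rw [avgNumerator_sub, avgWeight_sub, ← intervalIntegral.integral_const_mul]
  refine intervalIntegral.integral_mono_on hab
    (Continuous.intervalIntegrable (by fun_prop) _ _) (intervalIntegrable_avgNumerator _ _ _ _)
    fun s hs => ?_
  have := mul_le_mul_of_nonneg_left (h s hs) (integratingFactor_nonneg hε (ha.trans hs.1))
  rw [avgDensity]; linarith

@[simp] lemma avgWeight_zero (ε : ℝ) : avgWeight ε 0 = 0 := by simp [avgWeight]

@[simp] lemma avgNumerator_zero (ε : ℝ) (k : ℝ → unitInterval) : avgNumerator ε k 0 = 0 := by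
  simp [avgNumerator]

lemma avgNumerator_le_ramp_mul {ε a : ℝ} (hε : 0 < ε) (k : ℝ →o unitInterval) (ha : 0 ≤ a) :
    avgNumerator ε k a ≤ ramp ε a * avgWeight ε a := by
  -- The chain is J(s) ≤ r(s) ≤ r(a) ≤ r(a) (4 - 3 r(s)), since r ≤ 1.
  have := avgNumerator_sub_le (c := ramp ε a) hε k le_rfl ha fun s hs => by
    have h1 := windowMean_le_ramp hε k hs.1
    have h2 := ramp_mono hε hs.2
    have h3 := ramp_le_one ε s
    have h4 := ramp_nonneg hε ha
    nlinarith
  simpa using this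

/-- The value at `a` of the ratio whose weighted average is `avgNumerator / avgWeight`. -/
def avgRatio (ε : ℝ) (k : ℝ → unitInterval) (a : ℝ) : ℝ :=
  windowMean ε k a / (4 - 3 * ramp ε a)

lemma avgRatio_mul (ε : ℝ) (k : ℝ → unitInterval) (a : ℝ) :
    avgRatio ε k a * (4 - 3 * ramp ε a) = windowMean ε k a :=
  div_mul_cancel₀ _ (by linarith [ramp_le_one ε a])

lemma avgRatio_nonneg {ε a : ℝ} (hε : 0 < ε) (k : ℝ → unitInterval) (ha : 0 ≤ a) :
    0 ≤ avgRatio ε k a :=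
  div_nonneg (windowMean_nonneg hε k ha) (by linarith [ramp_le_one ε a])

lemma windowMean_le_avgRatio_mul {ε s a : ℝ} (hε : 0 < ε) (k : ℝ →o unitInterval) (hs : 0 ≤ s)
    (h : s ≤ a) : windowMean ε k s ≤ avgRatio ε k a * (4 - 3 * ramp ε s) :=
  calc _ ≤ windowMean ε k a := windowMean_mono hε k hs h
    _ = avgRatio ε k a * (4 - 3 * ramp ε a) := (avgRatio_mul ε k a).symm
    _ ≤ _ := mul_le_mul_of_nonneg_left (by linarith [ramp_mono hε h])
      (avgRatio_nonneg hε k (hs.trans h))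

lemma avgRatio_mul_le_windowMean {ε s a : ℝ} (hε : 0 < ε) (k : ℝ →o unitInterval) (ha : 0 ≤ a)
    (h : a ≤ s) : avgRatio ε k a * (4 - 3 * ramp ε s) ≤ windowMean ε k s :=
  calc _ ≤ avgRatio ε k a * (4 - 3 * ramp ε a) :=
        mul_le_mul_of_nonneg_left (by linarith [ramp_mono hε h]) (avgRatio_nonneg hε k ha)
    _ = windowMean ε k a := avgRatio_mul ε k a
    _ ≤ _ := windowMean_mono hε k ha h

/-- `avgRatio` is nondecreasing, so its value at a lies between its averages over [0, a] and over
[a, b]; extending the interval cannot lower the average. -/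
lemma avgNumerator_mul_le {ε a b : ℝ} (hε : 0 < ε) (k : ℝ →o unitInterval) (ha : 0 < a)
    (hab : a ≤ b) : avgNumerator ε k a * avgWeight ε b ≤ avgNumerator ε k b * avgWeight ε a := by
  have h1 := avgNumerator_sub_le (c := avgRatio ε k a) hε k le_rfl ha.le
    fun s hs => windowMean_le_avgRatio_mul hε k hs.1 hs.2
  have h2 := le_avgNumerator_sub (c := avgRatio ε k a) hε k ha.le hab
    fun s hs => avgRatio_mul_le_windowMean hε k ha.le hs.1
  rw [avgWeight_zero, avgNumerator_zero, sub_zero, sub_zero] at h1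
  have h3 := avgWeight_pos hε ha
  have h4 : 0 ≤ avgWeight ε b - avgWeight ε a := by
    rw [avgWeight_sub]
    exact intervalIntegral.integral_nonneg hab fun s hs =>
      (avgDensity_pos hε (ha.trans_le hs.1)).le
  nlinarith [mul_le_mul_of_nonneg_right h1 h4, mul_le_mul_of_nonneg_right h2 h3.le]

/-- The weighted average of `avgRatio ε k` over `[0, a]`. -/
def avg (ε : ℝ) (k : ℝ → unitInterval) (a : ℝ) : ℝ :=
  if a ≤ 0 then 0 else avgNumerator ε k a / avgWeight ε a

lemma avg_mem {ε : ℝ} (hε : 0 < ε) (k : ℝ →o unitInterval) (a : ℝ) :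
    avg ε k a ∈ Set.Icc (0 : ℝ) 1 := by
  unfold avg
  split_ifs with h
  · simp
  · push Not at h
    have hE := avgWeight_pos hε h
    refine ⟨div_nonneg (avgNumerator_nonneg hε k h.le) hE.le, (div_le_one hE).2 ?_⟩
    exact (avgNumerator_le_ramp_mul hε k h.le).trans
      (mul_le_of_le_one_left hE.le (ramp_le_one _ _))

lemma avg_monotone {ε : ℝ} (hε : 0 < ε) (k : ℝ →o unitInterval) : Monotone (avg ε k) := by
  intro a b hab
  by_cases ha : a ≤ 0
  · rw [avg, if_pos ha]; exact (avg_mem hε k b).1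
  · push Not at ha
    rw [avg, avg, if_neg ha.not_ge, if_neg (ha.trans_le hab).not_ge,
      div_le_div_iff₀ (avgWeight_pos hε ha) (avgWeight_pos hε (ha.trans_le hab))]
    exact avgNumerator_mul_le hε k ha hab

lemma avg_mono_left {ε : ℝ} (hε : 0 < ε) {k l : ℝ →o unitInterval} (h : k ≤ l) (a : ℝ) :
    avg ε k a ≤ avg ε l a := by
  unfold avg
  split_ifs with ha
  · exact le_rfl
  · push Not at ha
    have hE := avgWeight_pos hε ha
    gcongr
    exact intervalIntegral.integral_mono_on ha.le (intervalIntegrable_avgNumerator _ _ _ _)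
      (intervalIntegrable_avgNumerator _ _ _ _) fun s hs =>
      mul_le_mul_of_nonneg_left (windowMean_mono_left hε h hs.1)
        (integratingFactor_nonneg hε hs.1)

/-- The Knaster-Tarski theorem for operators on monotone functions. -/
lemma exists_monotone_fixedPoint {α β : Type*} [Preorder α] [CompleteLattice β]
    (T : (α → β) → α → β) (hT : ∀ k, Monotone k → Monotone (T k))
    (hmono : ∀ k l, Monotone k → Monotone l → (∀ a, k a ≤ l a) → ∀ a, T k a ≤ T l a) :
    ∃ k, Monotone k ∧ T k = k := by
  let T' : (α →o β) →o (α →o β) :=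
    ⟨fun k => ⟨T k, hT k k.monotone⟩, fun k l h => hmono k l k.monotone l.monotone h⟩
  have h : T' (OrderHom.lfp T') = OrderHom.lfp T' := OrderHom.map_lfp T'
  exact ⟨(OrderHom.lfp T' : α →o β), OrderHom.monotone _,
    congrArg (fun k : α →o β => (k : α → β)) h⟩

lemma exists_avg_eq_self {ε : ℝ} (hε : 0 < ε) :
    ∃ k : ℝ →o unitInterval, ∀ a, (k a : ℝ) = avg ε k a := by
  -- The projection makes T total on arbitrary functions; on monotone k it changes nothing, by
  -- `avg_mem`.
  let T : (ℝ → unitInterval) → ℝ → unitInterval :=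
    fun k a => Set.projIcc 0 1 zero_le_one (avg ε k a)
  have hT : ∀ k, Monotone k → Monotone (T k) := fun k hk a b h =>
    Set.monotone_projIcc _ (avg_monotone hε ⟨k, hk⟩ h)
  have hmono : ∀ k l, Monotone k → Monotone l → (∀ a, k a ≤ l a) → ∀ a, T k a ≤ T l a :=
    fun k l hk hl h a => Set.monotone_projIcc _
      (avg_mono_left hε (k := ⟨k, hk⟩) (l := ⟨l, hl⟩) h a)
  obtain ⟨k, hk, hTk⟩ := exists_monotone_fixedPoint T hT hmono
  refine ⟨⟨k, hk⟩, fun a => ?_⟩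
  have h1 : T k a = k a := congrFun hTk a
  have h2 : avg ε k a ∈ Set.Icc (0 : ℝ) 1 := avg_mem hε ⟨k, hk⟩ a
  change (k a : ℝ) = avg ε k a
  rw [← h1]
  simp only [T]
  rw [Set.projIcc_of_mem zero_le_one h2]

/-- This is (λ S)' = λ (4 - 3r) in integrated form. As S' = 2(1 - r), it requires λ'/λ = (2 - r)/S,
which is 1/s below ε and 1/ε above; hence the two branches of `integratingFactor`. -/
lemma avgWeight_eq {ε a : ℝ} (hε : 0 < ε) (ha : 0 ≤ a) :
    avgWeight ε a = integratingFactor ε a * kernelMass ε a := by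
  have hle : ∀ a, 0 ≤ a → a ≤ ε → avgWeight ε a = 2 * a ^ 2 - a ^ 3 / ε := by
    intro a ha h
    have : avgWeight ε a = ∫ s in (0 : ℝ)..a, (4 * s - (3 / ε) * s ^ 2) := by
      refine intervalIntegral.integral_congr fun s hs => ?_
      rw [Set.uIcc_of_le ha] at hs
      simp only [avgDensity, integratingFactor, if_pos (hs.2.trans h), ramp_of_le hε (hs.2.trans h)]
      ring
    rw [this, intervalIntegral.integral_sub (Continuous.intervalIntegrable (by fun_prop) _ _)
      (Continuous.intervalIntegrable (by fun_prop) _ _), intervalIntegral.integral_const_mul,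
      intervalIntegral.integral_const_mul, integral_id, integral_pow]
    field_simp; norm_num; ring
  rcases le_total a ε with h | h
  · rw [hle a ha h, kernelMass_of_le hε ha h, integratingFactor, if_pos h]; ring
  · have h1 := avgWeight_sub ε ε a
    have h2 : ∫ s in ε..a, avgDensity ε s = ε ^ 2 * Real.exp ((a - ε) / ε) - ε ^ 2 := by
      have hd : ∀ s ∈ Set.uIcc ε a,
          HasDerivAt (fun s => ε ^ 2 * Real.exp ((s - ε) / ε)) (avgDensity ε s) s := by
        intro s hs
        rw [Set.uIcc_of_le h] at hs
        have := ((((hasDerivAt_id s).sub_const ε).div_const ε).exp).const_mul (ε ^ 2)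
        refine this.congr_deriv ?_
        rw [avgDensity, ramp_of_ge hε hs.1, integratingFactor]
        split_ifs with h3
        · obtain rfl : s = ε := le_antisymm h3 hs.1
          simp; field_simp; norm_num
        · simp; field_simp; norm_num
      rw [intervalIntegral.integral_eq_sub_of_hasDerivAt hd
        ((continuous_avgDensity ε).intervalIntegrable _ _)]
      simp
    rw [h2, hle ε hε.le le_rfl] at h1
    rw [kernelMass_of_ge hε h, integratingFactor]
    split_ifs with h3
    · obtain rfl : a = ε := le_antisymm h3 h
      rw [hle a hε.le le_rfl]; field_simp; ring
    · field_simp at h1 ⊢; linarith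

/-! ### Regularity and strict monotonicity of the fixed point -/

section FixedPoint

variable {ε : ℝ} {k : ℝ →o unitInterval}

lemma fixedPoint_of_nonpos (hk : ∀ a, (k a : ℝ) = avg ε k a) {a : ℝ} (ha : a ≤ 0) :
    (k a : ℝ) = 0 := by
  rw [hk, avg, if_pos ha]

lemma fixedPoint_of_pos (hk : ∀ a, (k a : ℝ) = avg ε k a) {a : ℝ} (ha : 0 < a) :
    (k a : ℝ) = avgNumerator ε k a / avgWeight ε a := by
  rw [hk, avg, if_neg ha.not_ge]

lemma fixedPoint_le_ramp (hε : 0 < ε) (hk : ∀ a, (k a : ℝ) = avg ε k a) {a : ℝ} (ha : 0 ≤ a) :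
    (k a : ℝ) ≤ ramp ε a := by
  rcases ha.eq_or_lt with rfl | h
  · rw [fixedPoint_of_nonpos hk le_rfl]; exact ramp_nonneg hε le_rfl
  · rw [fixedPoint_of_pos hk h, div_le_iff₀ (avgWeight_pos hε h)]
    exact avgNumerator_le_ramp_mul hε k ha

lemma hasDerivAt_fixedPoint (hε : 0 < ε) (hk : ∀ a, (k a : ℝ) = avg ε k a) {a : ℝ}
    (ha : 0 < a) : HasDerivAt (fun x => (k x : ℝ))
      ((windowMean ε k a - (4 - 3 * ramp ε a) * k a) / kernelMass ε a) a := by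
  have hE := avgWeight_pos hε ha
  have := (hasDerivAt_avgNumerator ε k a).div (hasDerivAt_avgWeight ε a) hE.ne'
  refine (this.congr_of_eventuallyEq ?_).congr_deriv ?_
  · filter_upwards [lt_mem_nhds ha] with x hx using fixedPoint_of_pos hk hx
  · have hS := kernelMass_pos hε ha
    have hl := integratingFactor_pos hε ha
    have h1 : avgNumerator ε k a = k a * avgWeight ε a := by
      rw [fixedPoint_of_pos hk ha]; field_simp
    rw [h1, avgDensity, avgWeight_eq hε ha.le]
    field_simp

lemma continuous_fixedPoint (hε : 0 < ε) (hk : ∀ a, (k a : ℝ) = avg ε k a) :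
    Continuous fun x => (k x : ℝ) := by
  rw [continuous_iff_continuousAt]
  intro a
  rcases lt_or_ge 0 a with ha | ha
  · exact (hasDerivAt_fixedPoint hε hk ha).continuousAt
  -- At 0 the differential equation is singular because S(0) = 0; continuity there comes from
  -- squeezing k under the ramp.
  · have hlim : Filter.Tendsto (fun x => max 0 (ramp ε x)) (nhds a) (nhds 0) := by
      have h : max 0 (ramp ε a) = 0 := max_eq_left
        ((min_le_left _ _).trans (div_nonpos_of_nonpos_of_nonneg ha hε.le))
      have : Continuous fun x => max 0 (ramp ε x) := by fun_prop
      simpa only [h] using this.tendsto a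
    rw [ContinuousAt, fixedPoint_of_nonpos hk ha]
    refine squeeze_zero (fun x => (k x).2.1) (fun x => ?_) hlim
    rcases le_total x 0 with hx | hx
    · rw [fixedPoint_of_nonpos hk hx]; exact le_max_left _ _
    · exact (fixedPoint_le_ramp hε hk hx).trans (le_max_right _ _)

/-- Positivity spreads inward from the cap value 1 on [1, ∞), in steps of ε: if J is positive at s +
ε, then k is positive beyond s + ε, and the window at s reaches up to s + 2ε. -/
lemma windowMean_fixedPoint_pos_of_le (hε : 0 < ε) (hk : ∀ a, (k a : ℝ) = avg ε k a) (n : ℕ) :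
    ∀ s : ℝ, 0 < s → 1 ≤ s + n * ε → 0 < windowMean ε k s := by
  have hpos : ∀ s b, 0 < s → 0 < b → b ≤ 2 * s → b ≤ 2 * ε →
      (∀ x ∈ Set.Ioo 0 b, 0 < capped k (2 * ε + s - x)) → 0 < windowMean ε k s := by
    intro s b hs hb hbs hbε h
    rw [windowMean_eq]
    refine mul_pos (by positivity) ?_
    refine (intervalIntegral.intervalIntegral_pos_of_pos_on
      (intervalIntegrable_capped_sub k (2 * ε + s) 0 b) h hb).trans_le ?_
    exact intervalIntegral.integral_mono_interval le_rfl hb.le (le_min hbs hbε)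
      (Filter.Eventually.of_forall fun x => capped_nonneg _ _)
      (intervalIntegrable_capped_sub _ _ _ _)
  induction n with
  | zero =>
    intro s hs h
    refine hpos s (2 * min s ε) hs (by positivity) (by linarith [min_le_left s ε])
      (by linarith [min_le_right s ε]) fun x hx => ?_
    have h1 : ¬ 2 * ε + s - x < 1 := by
      have := hx.2
      have := min_le_right s ε
      simp at h
      linarith
    rw [capped, if_neg h1]; exact one_pos
  | succ n ih =>
    intro s hs h
    -- Only the part of the window above s + ε is used, hence no factor 2 here.
    refine hpos s (min s ε) hs (by positivity) (by linarith [min_le_left s ε])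
      (by linarith [min_le_right s ε]) fun x hx => ?_
    have hx2 : s + ε < 2 * ε + s - x := by linarith [hx.2, min_le_right s ε]
    have h0 : 0 < s + ε := by positivity
    have hJ : 0 < windowMean ε k (s + ε) := ih _ h0 (by push_cast at h; linarith)
    refine lt_of_lt_of_le ?_ (le_capped k _)
    rw [fixedPoint_of_pos hk (h0.trans hx2)]
    refine div_pos ?_ (avgWeight_pos hε (h0.trans hx2))
    have h1 := avgNumerator_nonneg hε k h0.le
    have h2 : 0 < avgNumerator ε k (2 * ε + s - x) - avgNumerator ε k (s + ε) := by
      rw [avgNumerator_sub]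
      exact intervalIntegral.intervalIntegral_pos_of_pos_on
        (intervalIntegrable_avgNumerator _ _ _ _)
        (fun t ht => mul_pos (integratingFactor_pos hε (h0.trans ht.1))
          (hJ.trans_le (windowMean_mono hε k h0.le ht.1.le))) hx2
    linarith

lemma windowMean_fixedPoint_pos (hε : 0 < ε) (hk : ∀ a, (k a : ℝ) = avg ε k a) {s : ℝ}
    (hs : 0 < s) : 0 < windowMean ε k s := by
  obtain ⟨n, hn⟩ := exists_nat_ge (1 / ε)
  refine windowMean_fixedPoint_pos_of_le hε hk n s hs ?_
  rw [div_le_iff₀ hε] at hn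
  linarith

lemma fixedPoint_pos (hε : 0 < ε) (hk : ∀ a, (k a : ℝ) = avg ε k a) {a : ℝ} (ha : 0 < a) :
    0 < (k a : ℝ) := by
  rw [fixedPoint_of_pos hk ha]
  exact div_pos (intervalIntegral.intervalIntegral_pos_of_pos_on
    (intervalIntegrable_avgNumerator _ _ _ _) (fun t ht => mul_pos (integratingFactor_pos hε ht.1)
      (windowMean_fixedPoint_pos hε hk ht.1)) ha) (avgWeight_pos hε ha)

/-- The average over [0, a] lies strictly below the endpoint ratio r, because near 0 it is bounded
by the ramp; b is chosen so that the ramp is at most r/2 on [0, b]. -/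
lemma fixedPoint_lt_avgRatio (hε : 0 < ε) (hk : ∀ a, (k a : ℝ) = avg ε k a) {a : ℝ}
    (ha : 0 < a) : avgNumerator ε k a < avgRatio ε k a * avgWeight ε a := by
  set r := avgRatio ε k a
  have hr : 0 < r := div_pos (windowMean_fixedPoint_pos hε hk ha) (by linarith [ramp_le_one ε a])
  set b := min a (ε * r / 2)
  have hb : 0 < b := by positivity
  have h1 := avgNumerator_le_ramp_mul hε k hb.le
  have h2 : ramp ε b ≤ r / 2 := (min_le_left _ _).trans (by
    rw [div_le_iff₀ hε]; linarith [min_le_right a (ε * r / 2)])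
  have h3 := avgNumerator_sub_le (c := r) hε k hb.le (min_le_left a (ε * r / 2))
    fun s hs => windowMean_le_avgRatio_mul hε k (hb.le.trans hs.1) hs.2
  have hE := avgWeight_pos hε hb
  nlinarith [mul_le_mul_of_nonneg_right h2 hE.le, mul_pos hr hE]

lemma fixedPoint_strictMonoOn (hε : 0 < ε) (hk : ∀ a, (k a : ℝ) = avg ε k a) :
    StrictMonoOn (fun x => (k x : ℝ)) (Set.Ici 0) := by
  intro a ha b _ hab
  rcases (Set.mem_Ici.1 ha).eq_or_lt with rfl | ha
  · simp only [fixedPoint_of_nonpos hk le_rfl]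
    exact fixedPoint_pos hε hk hab
  · have hEa := avgWeight_pos hε ha
    have hEb := avgWeight_pos hε (ha.trans hab)
    simp only [fixedPoint_of_pos hk ha, fixedPoint_of_pos hk (ha.trans hab)]
    rw [div_lt_div_iff₀ hEa hEb]
    have h1 := fixedPoint_lt_avgRatio hε hk ha
    have h2 := le_avgNumerator_sub (c := avgRatio ε k a) hε k ha.le hab.le
      fun s hs => avgRatio_mul_le_windowMean hε k ha.le hs.1
    have h4 : 0 < avgWeight ε b - avgWeight ε a := by
      rw [avgWeight_sub]
      exact intervalIntegral.intervalIntegral_pos_of_pos_on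
        ((continuous_avgDensity ε).intervalIntegrable _ _)
        (fun s hs => avgDensity_pos hε (ha.trans hs.1)) hab
    nlinarith [mul_lt_mul_of_pos_right h1 h4, mul_le_mul_of_nonneg_right h2 hEa.le]

/-! ### Constancy of the value at the fixed point -/

/-- The slope is 1/(2ε) on a window that may stick out beyond 1. Since `capped k` equals 1 there, 1
- `capped k` vanishes and the whole window may be used; its length is 2ε times the ramp. -/
lemma integral_mul_kernelSlope (hε : 0 < ε) {s : ℝ} (hs : 0 ≤ s) (hs1 : s ≤ 1) :
    ∫ w in s..1, (1 - (k w : ℝ)) / 2 * kernelSlope ε s w = (ramp ε s - windowMean ε k s) / 2 := by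
  have hL : max s (2 * ε - s) ≤ 2 * ε + s := max_le (by linarith) (by linarith)
  have h1 : ∫ w in s..1, (1 - (k w : ℝ)) / 2 * kernelSlope ε s w =
      ∫ w in max s (2 * ε - s)..2 * ε + s, 1 / (4 * ε) * (1 - capped k w) := by
    rw [intervalIntegral.integral_of_le hs1, intervalIntegral.integral_of_le hL,
      integral_Ioc_eq_integral_Ioo, integral_Ioc_eq_integral_Ioo,
      ← integral_indicator measurableSet_Ioo, ← integral_indicator measurableSet_Ioo]
    congr 1
    funext w
    simp only [Set.indicator, Set.mem_Ioo, kernelSlope, capped, abs_lt, max_lt_iff]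
    by_cases hw : w < 1
    · by_cases hw2 : s < w ∧ 2 * ε - s < w ∧ w < 2 * ε + s
      · rw [if_pos ⟨hw2.1, hw⟩, if_pos ⟨by linarith, by linarith⟩,
          if_pos ⟨⟨hw2.1, hw2.2.1⟩, hw2.2.2⟩, if_pos hw]
        field_simp; norm_num
      · rw [if_neg (c := (s < w ∧ 2 * ε - s < w) ∧ w < 2 * ε + s) (by tauto)]
        split_ifs with h3 h4
        · exact absurd ⟨h3.1, by linarith, by linarith⟩ hw2
        · simp
        · rfl
    · rw [if_neg (by tauto), if_neg hw]; simp
  have h2 : 1 / (4 * ε) * (2 * ε + s - max s (2 * ε - s)) = ramp ε s / 2 := by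
    rcases le_total s ε with h | h
    · rw [max_eq_right (by linarith), ramp_of_le hε h]; field_simp; ring
    · rw [max_eq_left (by linarith), ramp_of_ge hε h]; field_simp; ring
  rw [h1, intervalIntegral.integral_const_mul, intervalIntegral.integral_sub
    intervalIntegrable_const (intervalIntegrable_capped _ _ _), mul_sub,
    intervalIntegral.integral_const, smul_eq_mul, mul_one, h2, windowMean]
  field_simp; ring

/-- K(a, w) is K(w, w) minus the integral of its slope from a to w; exchanging the order leaves a in
the limits of integration only. The value can then be differentiated in a by the fundamental theorem
of calculus, with no derivative under the integral. -/
lemma integral_mul_pairKernel_fixedPoint (hε : 0 < ε) {a : ℝ} (ha : 0 ≤ a) (ha1 : a ≤ 1) :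
    ∫ w in a..1, (1 - (1 + (k w : ℝ)) / 2) * pairKernel ε a w =
      ∫ s in a..1, ((1 - (k s : ℝ)) / 2 * (2 - ramp ε s) -
        (ramp ε s - windowMean ε k s) / 2) := by
  have hkm : Measurable fun x => (k x : ℝ) := measurable_subtype_coe.comp k.monotone.measurable
  have hb : ∀ x, |(1 - (k x : ℝ)) / 2| ≤ 1 := fun x => by
    rw [abs_le]; constructor <;> linarith [(k x).2.1, (k x).2.2]
  have hm : Measurable fun x => (1 - (k x : ℝ)) / 2 := (measurable_const.sub hkm).div_const 2
  have hslope : ∀ s w, |kernelSlope ε s w| ≤ 1 / (2 * ε) := fun s w => by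
    unfold kernelSlope
    split_ifs
    · rw [abs_of_nonneg (by positivity)]
    · rw [abs_zero]; positivity
  have hF : Measurable fun x : ℝ × ℝ => (1 - (k x.2 : ℝ)) / 2 * kernelSlope ε x.1 x.2 :=
    (hm.comp measurable_snd).mul (measurable_kernelSlope ε)
  have htri := integral_integral_triangle (a := a) (b := 1) (C := 1 * (1 / (2 * ε)))
    (F := fun s w => (1 - (k w : ℝ)) / 2 * kernelSlope ε s w) hF (fun s w => by
      rw [abs_mul]; exact mul_le_mul (hb w) (hslope s w) (abs_nonneg _) zero_le_one) ha1
  have h1 : ∫ s in a..1, ∫ w in s..1, (1 - (k w : ℝ)) / 2 * kernelSlope ε s w =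
      ∫ s in a..1, (ramp ε s - windowMean ε k s) / 2 := by
    refine intervalIntegral.integral_congr fun s hs => ?_
    rw [Set.uIcc_of_le ha1] at hs
    exact integral_mul_kernelSlope hε (ha.trans hs.1) hs.2
  have h2 : ∫ w in a..1, ∫ s in a..w, (1 - (k w : ℝ)) / 2 * kernelSlope ε s w =
      ∫ w in a..1, ((1 - (k w : ℝ)) / 2 * (2 - ramp ε w) -
        (1 - (1 + (k w : ℝ)) / 2) * pairKernel ε a w) := by
    refine intervalIntegral.integral_congr fun w hw => ?_
    rw [Set.uIcc_of_le ha1] at hw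
    rw [intervalIntegral.integral_const_mul, integral_kernelSlope hε ha hw.1,
      pairKernel_self hε (ha.trans hw.1)]
    ring
  have hi := intervalIntegrable_of_bound hm hb a 1
  have hi1 : IntervalIntegrable (fun w => (1 - (k w : ℝ)) / 2 * (2 - ramp ε w)) volume a 1 :=
    hi.mul_continuousOn (Continuous.continuousOn (by fun_prop))
  have hi2 : IntervalIntegrable (fun w => (1 - (1 + (k w : ℝ)) / 2) * pairKernel ε a w)
      volume a 1 := by
    have : (fun w => (1 - (1 + (k w : ℝ)) / 2) * pairKernel ε a w) =
      fun w => (1 - (k w : ℝ)) / 2 * pairKernel ε a w := by funext w; ring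
    rw [this]
    exact hi.mul_continuousOn ((continuous_pairKernel ε).comp
      (by fun_prop : Continuous fun w : ℝ => (a, w))).continuousOn
  rw [intervalIntegral.integral_sub hi1 (Continuous.intervalIntegrable (by fun_prop) _ _), ← h1,
    htri, h2, intervalIntegral.integral_sub hi1 hi2]
  ring

/-- The max rule built from the fixed point has the same value at all magnitudes. -/
lemma maxRuleValue_fixedPoint (hε : 0 < ε) (hk : ∀ a, (k a : ℝ) = avg ε k a) {a : ℝ}
    (ha : a ∈ Set.Icc (0 : ℝ) 1) :
    maxRuleValue ε (fun x => (1 + (k x : ℝ)) / 2) a =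
      maxRuleValue ε (fun x => (1 + (k x : ℝ)) / 2) 1 := by
  have hkc := continuous_fixedPoint hε hk
  set G : ℝ → ℝ := fun s => (1 - (k s : ℝ)) / 2 * (2 - ramp ε s) -
    (ramp ε s - windowMean ε k s) / 2
  have hG : Continuous G := by fun_prop
  set W : ℝ → ℝ := fun a => (1 + (k a : ℝ)) / 2 * kernelMass ε a - ∫ s in (1 : ℝ)..a, G s
  have hW : ∀ a ∈ Set.Icc (0 : ℝ) 1, maxRuleValue ε (fun x => (1 + (k x : ℝ)) / 2) a = W a := by
    intro a ha
    rw [maxRuleValue, integral_mul_pairKernel_fixedPoint hε ha.1 ha.2,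
      intervalIntegral.integral_symm, ← sub_eq_add_neg]
  rw [hW a ha, hW 1 ⟨zero_le_one, le_rfl⟩]
  rcases ha.2.eq_or_lt with rfl | ha1
  · rfl
  have hprim : ∀ x, HasDerivAt (fun a => ∫ s in (1 : ℝ)..a, G s) (G x) x := fun x =>
    (hG.integral_hasStrictDerivAt 1 x).hasDerivAt
  have hWc : Continuous W := by
    refine Continuous.sub (by fun_prop) ?_
    exact continuous_iff_continuousAt.2 fun x => (hprim x).continuousAt
  -- The open interval avoids 0, where k is only known to be continuous. The derivative vanishes
  -- exactly by S k' + (4 - 3r) k = J.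
  have hWd : ∀ x ∈ Set.Ioo a 1, HasDerivAt W 0 x := by
    intro x hx
    have hx0 : 0 < x := ha.1.trans_lt hx.1
    have := ((((hasDerivAt_fixedPoint hε hk hx0).const_add 1).div_const 2).mul
      (hasDerivAt_kernelMass hε hx0)).sub (hprim x)
    refine this.congr_deriv ?_
    have hS := kernelMass_pos hε hx0
    simp only [G]
    field_simp
    ring
  obtain ⟨c, _, hc⟩ := exists_hasDerivAt_eq_slope W (fun _ => 0) ha1 hWc.continuousOn hWd
  rw [eq_div_iff (by linarith), zero_mul] at hc
  linarith

end FixedPoint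

/-- There is a continuous, strictly increasing max rule under which the quack's payoff does not
depend on his message. -/
lemma exists_maxRuleValue_const {ε : ℝ} (hε : 0 < ε) (hε1 : ε < 1) :
    ∃ g : ℝ → ℝ, Continuous g ∧ Monotone g ∧ StrictMonoOn g (Set.Ici 0) ∧
      (∀ x, g x ∈ Set.Icc (0 : ℝ) 1) ∧ g 0 = 1 / 2 ∧ g 1 = 1 - ε / 3 ∧
      ∀ a ∈ Set.Icc (0 : ℝ) 1, maxRuleValue ε g a = ε - ε ^ 2 / 3 := by
  obtain ⟨k, hk⟩ := exists_avg_eq_self hε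
  have hkc := continuous_fixedPoint hε hk
  set g : ℝ → ℝ := fun x => (1 + (k x : ℝ)) / 2
  have hgm : ∀ x, g x ∈ Set.Icc (0 : ℝ) 1 := fun x =>
    ⟨by simp only [g]; linarith [(k x).2.1], by simp only [g]; linarith [(k x).2.2]⟩
  have hgc : Continuous g := by fun_prop
  have hc : maxRuleValue ε g 1 = ε - ε ^ 2 / 3 :=
    maxRuleValue_eq_of_const (C := 1) hε hε1 hgc.measurable
      (fun x => by rw [abs_of_nonneg (hgm x).1]; exact (hgm x).2)
      fun a ha => maxRuleValue_fixedPoint hε hk ⟨ha.1.le, ha.2⟩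
  refine ⟨g, hgc, fun a b h => ?_, fun a ha b hb h => ?_, hgm, ?_, ?_, fun a ha => ?_⟩
  · have : (k a : ℝ) ≤ k b := k.monotone h
    simp only [g]; linarith
  · have : (k a : ℝ) < k b := fixedPoint_strictMonoOn hε hk ha hb h
    simp only [g]; linarith
  · simp only [g, fixedPoint_of_nonpos hk le_rfl, add_zero]
  -- No state is more extreme than 1, so the value there is g(1) ε.
  · rw [maxRuleValue, intervalIntegral.integral_same, kernelMass_of_ge hε hε1.le] at hc
    have : g 1 * ε = (1 - ε / 3) * ε := by rw [add_zero] at hc; rw [hc]; ring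
    exact mul_right_cancel₀ hε.ne' this
  · rw [maxRuleValue_fixedPoint hε hk ha, hc]

/-! ### The quack's payoff as a value of the max rule -/

lemma integral_uniformLaw {a b : ℝ} (h : a ≤ b) (F : ℝ → ℝ) :
    ∫ x : Set.Icc a b, F x ∂(uniformLaw a b) = (b - a)⁻¹ * ∫ x in a..b, F x := by
  have hvol : ((volume : Measure ℝ).comap Subtype.val) (Set.univ : Set (Set.Icc a b)) =
      ENNReal.ofReal (b - a) := by
    rw [(MeasurableEmbedding.subtype_coe measurableSet_Icc).comap_apply, Set.image_univ,
      Subtype.range_coe, Real.volume_Icc]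
  rw [uniformLaw, ProbabilityTheory.cond, hvol, Measure.restrict_univ, integral_smul_measure,
    integral_subtype_comap measurableSet_Icc F, intervalIntegral.integral_of_le h,
    integral_Icc_eq_integral_Ioc, ENNReal.toReal_inv, ENNReal.toReal_ofReal (by linarith),
    smul_eq_mul]

lemma integral_ite_abs_sub_le {ε : ℝ} (hε : 0 < ε) (d y : ℝ) :
    (ε - -ε)⁻¹ * ∫ e in (-ε)..ε, (if |d - e| ≤ ε then y else 0) = y * tent ε d := by
  have hi : ∀ e, (if |d - e| ≤ ε then y else 0) =
      (Set.Icc (d - ε) (d + ε)).indicator (fun _ => y) e := by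
    intro e
    have : |d - e| ≤ ε ↔ e ∈ Set.Icc (d - ε) (d + ε) := by
      rw [abs_le, Set.mem_Icc]
      constructor <;> rintro ⟨h1, h2⟩ <;> constructor <;> linarith
    simp only [this, Set.indicator]
  simp only [hi]
  have hlen : max (min ε (d + ε) - max (-ε) (d - ε)) 0 = 2 * ε * tent ε d := by
    rw [tent, mul_max_of_nonneg _ _ (by positivity), mul_zero, max_comm]
    congr 1
    have : 2 * ε * (1 - |d| / (2 * ε)) = 2 * ε - |d| := by field_simp
    rw [this]
    rcases le_total 0 d with h | h
    · rw [abs_of_nonneg h, min_eq_left (by linarith), max_eq_right (by linarith)]; ring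
    · rw [abs_of_nonpos h, min_eq_right (by linarith), max_eq_left (by linarith)]; ring
  rw [intervalIntegral.integral_of_le (by linarith), ← integral_Icc_eq_integral_Ioc,
    setIntegral_indicator measurableSet_Icc, Set.Icc_inter_Icc, setIntegral_const,
    measureReal_def, Real.volume_Icc, ENNReal.toReal_ofReal']
  change (ε - -ε)⁻¹ * (max (min ε (d + ε) - max (-ε) (d - ε)) 0 • y) = _
  rw [hlen, smul_eq_mul]
  field_simp; norm_num

lemma SelectionRule.prob_add_prob (φ : SelectionRule) (i : Fin 2) (m m' : Message) (s : ℝ) :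
    φ.prob i m m' s + φ.prob (1 - i) m' m s = 1 := by
  fin_cases i <;> simp [SelectionRule.prob]

/-- The truthful message is always consistent, so an inconsistent quack loses, and two inconsistent
messages never occur. `prob_add_prob` converts the expert's chances into the quack's. -/
lemma FollowsMaxRule.prob_eq {ε : ℝ} {f : unitInterval → unitInterval} {φ : SelectionRule}
    (h : FollowsMaxRule ε f φ) {G : ℝ → ℝ} (hG : ∀ x : unitInterval, G x = f x) (q : Fin 2)
    {m ω : Message} (hne : |(ω : ℝ)| ≠ |(m : ℝ)|) {e : ℝ} (he : |e| ≤ ε) :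
    φ.prob q m ω (ω + e) = if |(m : ℝ) - ω - e| ≤ ε then
      (if |(ω : ℝ)| < |(m : ℝ)| then G |(m : ℝ)| else 1 - G |(ω : ℝ)|) else 0 := by
  have hω : Consistent ε ω (ω + e) := by rw [Consistent]; simpa using he
  have hadd := φ.prob_add_prob q m ω (ω + e)
  have hm : Consistent ε m (ω + e) ↔ |(m : ℝ) - ω - e| ≤ ε := by rw [Consistent, sub_sub]
  split_ifs with h1 h2 <;> rw [← hm] at h1
  · rw [h.both_consistent q m ω _ h1 hω h2, ← hG]
    simp only [extremity, max_eq_left h2.le]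
  · have h3 := lt_of_le_of_ne (not_lt.1 h2) hne.symm
    rw [h.both_consistent (1 - q) ω m _ hω h1 h3, ← hG] at hadd
    simp only [extremity, max_eq_left h3.le] at hadd
    linarith
  · rw [h.unique_consistent (1 - q) ω m _ hω h1] at hadd
    linarith

lemma integral_symm_interval {F : ℝ → ℝ} (hF : ∀ a b, IntervalIntegrable F volume a b) :
    ∫ x in (-1 : ℝ)..1, F x = ∫ x in (0 : ℝ)..1, (F x + F (-x)) := by
  have hneg : IntervalIntegrable (fun x => F (-x)) volume 0 1 := by
    simpa using (IntervalIntegrable.iff_comp_neg (f := F) (a := 0) (b := -1)).1 (hF 0 (-1))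
  rw [intervalIntegral.integral_add (hF 0 1) hneg, intervalIntegral.integral_comp_neg, neg_zero,
    add_comm, intervalIntegral.integral_add_adjacent_intervals (hF _ _) (hF _ _)]

lemma pairKernel_abs (ε m w : ℝ) : pairKernel ε |m| w = tent ε (m - w) + tent ε (m + w) := by
  rcases abs_choice m with h | h
  · rw [h, pairKernel]
  · rw [h, pairKernel, ← tent_neg ε (-m - w), ← tent_neg ε (-m + w), add_comm]
    congr 2 <;> ring

/-- The quack's payoff in terms of the value of the max rule. -/
lemma quackPayoff_eq {ε : ℝ} (hε : 0 < ε) {f : unitInterval → unitInterval} {φ : SelectionRule}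
    (h : FollowsMaxRule ε f φ) {G : ℝ → ℝ} (hG : ∀ x : unitInterval, G x = f x)
    (hGm : Measurable G) (hGb : ∀ x, |G x| ≤ 1) (q : Fin 2) (m : Message) :
    quackPayoff ε truthTelling φ q m = 1 / 2 * maxRuleValue ε G |(m : ℝ)| := by
  set a := |(m : ℝ)|
  have ha0 : 0 ≤ a := abs_nonneg _
  have ha1 : a ≤ 1 := abs_le.2 m.2
  set v : ℝ → ℝ := fun w => if w < a then G a else 1 - G w
  have hvm : Measurable v :=
    Measurable.ite measurableSet_Iio measurable_const (measurable_const.sub hGm)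
  have hvb : ∀ w, |v w| ≤ 2 := fun w => by
    simp only [v]
    split_ifs
    · linarith [hGb a]
    · exact (abs_sub _ _).trans (by rw [abs_one]; linarith [hGb w])
  set I : Message → ℝ := fun ω => ∫ e : Set.Icc (-ε) ε, φ.prob q m ω (ω + e) ∂(uniformLaw (-ε) ε)
  have hI : ∀ ω : Message, |(ω : ℝ)| ≠ a → I ω = v |(ω : ℝ)| * tent ε (m - ω) := by
    intro ω hω
    rw [← integral_ite_abs_sub_le hε, ← integral_uniformLaw (by linarith)
      fun e => if |(m : ℝ) - ω - e| ≤ ε then v |(ω : ℝ)| else 0]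
    refine integral_congr_ae (Filter.Eventually.of_forall fun e => ?_)
    exact h.prob_eq hG q hω (abs_le.2 e.2)
  have h1 : quackPayoff ε truthTelling φ q m = ∫ ω, I ω ∂(uniformLaw (-1) 1) := by
    simp only [quackPayoff, truthTelling, Kernel.id_apply, integral_dirac, I]
  set I' : ℝ → ℝ := fun x => I (Set.projIcc (-1) 1 (by norm_num) x)
  have h2 : ∫ ω, I ω ∂(uniformLaw (-1) 1) = 1 / 2 * ∫ x in (-1 : ℝ)..1, I' x := by
    have : ∀ ω : Message, I ω = I' ω := fun ω => by simp only [I', Set.projIcc_val]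
    simp only [this]
    rw [integral_uniformLaw (by norm_num) I']
    norm_num
  have h3 : ∫ x in (-1 : ℝ)..1, I' x = ∫ x in (-1 : ℝ)..1, v |x| * tent ε (m - x) := by
    refine intervalIntegral.integral_congr_ae ?_
    -- Ties, on which the rule is unrestricted, occur only in these two states.
    have hfin : ({a, -a} : Set ℝ).Finite := Set.toFinite _
    filter_upwards [compl_mem_ae_iff.2 (hfin.measure_zero volume)] with x hx hx1
    rw [Set.uIoc_of_le (by norm_num)] at hx1
    have hmem : x ∈ Set.Icc (-1 : ℝ) 1 := ⟨hx1.1.le, hx1.2⟩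
    simp only [I', Set.projIcc_of_mem _ hmem]
    refine hI ⟨x, hmem⟩ fun hxa => hx ?_
    simpa [Set.mem_insert_iff, Set.mem_singleton_iff] using eq_or_eq_neg_of_abs_eq hxa
  have hint : ∀ u w, IntervalIntegrable (fun x => v |x| * tent ε (m - x)) volume u w :=
    fun u w => (intervalIntegrable_of_bound (hvm.comp measurable_id.abs) (fun x => hvb |x|) u
      w).mul_continuousOn (Continuous.continuousOn (by fun_prop))
  have h4 : ∫ x in (-1 : ℝ)..1, v |x| * tent ε (m - x) =
      ∫ w in (0 : ℝ)..1, v w * pairKernel ε a w := by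
    rw [integral_symm_interval hint]
    refine intervalIntegral.integral_congr fun w hw => ?_
    rw [Set.uIcc_of_le zero_le_one] at hw
    simp only [abs_neg, abs_of_nonneg hw.1, sub_neg_eq_add, a, pairKernel_abs]
    ring
  have hint' : ∀ u w, IntervalIntegrable (fun x => v x * pairKernel ε a x) volume u w :=
    fun u w => (intervalIntegrable_of_bound hvm hvb u w).mul_continuousOn
      ((continuous_pairKernel ε).comp
        (by fun_prop : Continuous fun w : ℝ => (a, w))).continuousOn
  have h5 : ∫ w in (0 : ℝ)..a, v w * pairKernel ε a w = G a * kernelMass ε a := by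
    rw [kernelMass, ← intervalIntegral.integral_const_mul, intervalIntegral.integral_of_le ha0,
      intervalIntegral.integral_of_le ha0, integral_Ioc_eq_integral_Ioo,
      integral_Ioc_eq_integral_Ioo]
    refine setIntegral_congr_fun measurableSet_Ioo fun w hw => ?_
    simp only [v, if_pos hw.2]
  have h6 : ∫ w in a..1, v w * pairKernel ε a w = ∫ w in a..1, (1 - G w) * pairKernel ε a w := by
    refine intervalIntegral.integral_congr fun w hw => ?_
    rw [Set.uIcc_of_le ha1] at hw
    simp only [v, if_neg hw.1.not_gt]
  rw [h1, h2, h3, h4, ← intervalIntegral.integral_add_adjacent_intervals (hint' 0 a) (hint' a 1),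
    h5, h6, maxRuleValue]

/-! ### Selection rules that follow a max rule -/

lemma FollowsMaxRule.apply_zero {ε : ℝ} (hε : 0 < ε) {f : unitInterval → unitInterval}
    {φ : SelectionRule} (h : FollowsMaxRule ε f φ) : (f 0 : ℝ) = 1 / 2 := by
  let z : Message := ⟨0, by norm_num⟩
  have hz : Consistent ε z 0 := by simp [Consistent, z, hε.le]
  have he : extremity z z = 0 := Subtype.ext (by simp [extremity, z])
  have h0 := h.both_consistent_zero 0 z z 0 hz hz he
  have h1 := h.both_consistent_zero 1 z z 0 hz hz he
  have h2 := φ.prob_add_prob 0 z z 0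
  simp only [sub_zero] at h2
  rw [h0, h1, he] at h2
  linarith

/-- A max rule is measurable, because it can be read off a measurable selection rule. -/
lemma FollowsMaxRule.measurable {ε : ℝ} (hε0 : 0 < ε) (hε1 : ε < 1)
    {f : unitInterval → unitInterval} {φ : SelectionRule} (h : FollowsMaxRule ε f φ) :
    Measurable f := by
  -- At the signal x the messages x and (1 - ε) x are both consistent, as they differ by εx ≤ ε, and
  -- the first is strictly more extreme when x > 0; so f(x) is a value of the measurable rule.
  let m : unitInterval → Message := fun x => ⟨x, by linarith [x.2.1], x.2.2⟩
  let m' : unitInterval → Message := fun x => ⟨(1 - ε) * x,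
    by nlinarith [x.2.1, x.2.2], by nlinarith [x.2.1, x.2.2]⟩
  have hf : f = fun x => φ.first (m x) (m' x) x := by
    funext x
    have hx := x.2.1
    have hm : Consistent ε (m x) x := by simp [Consistent, m, hε0.le]
    have hm' : Consistent ε (m' x) x := by
      have : (1 - ε) * (x : ℝ) - x = -(ε * x) := by ring
      simp only [Consistent, m', this, abs_neg]
      rw [abs_of_nonneg (by positivity)]
      nlinarith [x.2.2]
    have habs : |(m' x : ℝ)| = (1 - ε) * x := abs_of_nonneg (mul_nonneg (by linarith) hx)
    have habs' : |(m x : ℝ)| = x := abs_of_nonneg hx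
    have he : extremity (m x) (m' x) = x := by
      refine Subtype.ext ?_
      simp only [extremity, habs, habs']
      exact max_eq_left (by nlinarith)
    have hp : φ.prob 0 (m x) (m' x) x = f x := by
      rcases hx.eq_or_lt with h0 | h0
      · rw [h.both_consistent_zero 0 _ _ _ hm hm' (he.trans (Subtype.ext h0.symm)), he]
      · rw [h.both_consistent 0 _ _ _ hm hm' (by rw [habs, habs']; nlinarith), he]
    exact Subtype.ext (by rw [← hp]; simp [SelectionRule.prob])
  have hmm : Measurable m := measurable_subtype_coe.subtype_mk
  have hmm' : Measurable m' := (measurable_subtype_coe.const_mul (1 - ε)).subtype_mk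
  rw [hf]
  exact φ.measurable_first.comp (hmm.prodMk (hmm'.prodMk measurable_subtype_coe))

open Classical in
/-- The selection rule that follows the max rule `f` and tosses a fair coin wherever the max rule
is silent. -/
def maxSelection (ε : ℝ) (f : unitInterval → unitInterval) (m₁ m₂ : Message) (s : ℝ) :
    unitInterval :=
  if Consistent ε m₁ s then
    if Consistent ε m₂ s then
      if |(m₂ : ℝ)| < |(m₁ : ℝ)| then f (extremity m₁ m₂)
      else if |(m₁ : ℝ)| < |(m₂ : ℝ)| then unitInterval.symm (f (extremity m₁ m₂))
      else ⟨1 / 2, by norm_num, by norm_num⟩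
    else 1
  else if Consistent ε m₂ s then 0 else ⟨1 / 2, by norm_num, by norm_num⟩

lemma measurable_maxSelection (ε : ℝ) {f : unitInterval → unitInterval} (hf : Measurable f) :
    Measurable fun x : Message × Message × ℝ => maxSelection ε f x.1 x.2.1 x.2.2 := by
  have h1 : Measurable fun x : Message × Message × ℝ => (x.1 : ℝ) :=
    measurable_subtype_coe.comp measurable_fst
  have h2 : Measurable fun x : Message × Message × ℝ => (x.2.1 : ℝ) :=
    measurable_subtype_coe.comp (measurable_fst.comp measurable_snd)
  have h3 : Measurable fun x : Message × Message × ℝ => x.2.2 :=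
    measurable_snd.comp measurable_snd
  have hc1 : MeasurableSet {x : Message × Message × ℝ | Consistent ε x.1 x.2.2} :=
    measurableSet_le (h1.sub h3).abs measurable_const
  have hc2 : MeasurableSet {x : Message × Message × ℝ | Consistent ε x.2.1 x.2.2} :=
    measurableSet_le (h2.sub h3).abs measurable_const
  have he : Measurable fun x : Message × Message × ℝ => extremity x.1 x.2.1 :=
    (h1.abs.max h2.abs).subtype_mk
  exact Measurable.ite hc1 (Measurable.ite hc2 (Measurable.ite (measurableSet_lt h2.abs h1.abs)
    (hf.comp he) (Measurable.ite (measurableSet_lt h1.abs h2.abs)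
      (unitInterval.continuous_symm.measurable.comp (hf.comp he)) measurable_const))
    measurable_const) (Measurable.ite hc2 measurable_const measurable_const)

lemma extremity_comm (m m' : Message) : extremity m m' = extremity m' m :=
  Subtype.ext (max_comm _ _)

lemma exists_followsMaxRule (ε : ℝ) {f : unitInterval → unitInterval} (hf : Measurable f)
    (hf0 : (f 0 : ℝ) = 1 / 2) : ∃ φ : SelectionRule, FollowsMaxRule ε f φ := by
  let φ : SelectionRule := ⟨maxSelection ε f, measurable_maxSelection ε hf⟩
  have hsymm : φ.Symmetric := by
    intro m m' s
    simp only [SelectionRule.prob, φ, maxSelection, if_true, one_ne_zero, if_false,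
      extremity_comm m' m]
    by_cases h1 : Consistent ε m s <;> by_cases h2 : Consistent ε m' s <;>
      simp only [h1, h2, if_true, if_false]
    · rcases lt_trichotomy |(m : ℝ)| |(m' : ℝ)| with h | h | h
      · simp [h, h.not_gt]
      · simp [h]; norm_num
      · simp [h, h.not_gt]
    · simp
    · simp
    · norm_num
  have hprob : ∀ i m m' s, φ.prob i m m' s = φ.prob 0 m m' s := by
    intro i m m' s
    fin_cases i
    · rfl
    · exact (hsymm m m' s).symm
  refine ⟨φ, hsymm, fun i m m' s h1 h2 => ?_, fun i m m' s h1 h2 h => ?_, fun i m m' s h1 h2 h => ?_⟩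
  · rw [hprob]; simp [SelectionRule.prob, φ, maxSelection, h1, h2]
  · rw [hprob]; simp [SelectionRule.prob, φ, maxSelection, h1, h2, h]
  · have hz : max |(m : ℝ)| |(m' : ℝ)| = 0 := congrArg Subtype.val h
    have hm : |(m : ℝ)| = 0 := le_antisymm ((le_max_left _ _).trans_eq hz) (abs_nonneg _)
    have hm' : |(m' : ℝ)| = 0 := le_antisymm ((le_max_right _ _).trans_eq hz) (abs_nonneg _)
    rw [hprob, h, hf0]
    simp only [SelectionRule.prob, φ, maxSelection, h1, h2, if_true, hm, hm', lt_irrefl, if_false]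

end

theorem lemma1 (ε : ℝ) (hε0 : 0 < ε) (hε1 : ε < 1) :
    ∃ f : unitInterval → unitInterval,
      (∃ φ : SelectionRule, FollowsMaxRule ε f φ) ∧
      (∀ φ : SelectionRule, FollowsMaxRule ε f φ → QuackIndifferent ε φ) ∧
      (∀ (g : unitInterval → unitInterval) (φ : SelectionRule),
        FollowsMaxRule ε g φ → QuackIndifferent ε φ → g = f) ∧
      StrictMono f ∧
      Set.range (fun x => (f x : ℝ)) = Set.Icc (1 / 2) (1 - ε / 3) := by
  obtain ⟨G, hGc, hGmono, hGs, hGI, hG0, hG1, hGv⟩ := exists_maxRuleValue_const hε0 hε1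
  have hGb : ∀ x, |G x| ≤ 1 := fun x => by rw [abs_of_nonneg (hGI x).1]; exact (hGI x).2
  let f : unitInterval → unitInterval := fun x => ⟨G x, hGI x⟩
  have hf : Measurable f := (hGc.measurable.comp measurable_subtype_coe).subtype_mk
  refine ⟨f, exists_followsMaxRule ε hf hG0, fun φ hφ q m m' => ?_, fun g φ hφ hind => ?_,
    fun x y h => hGs x.2.1 y.2.1 h, ?_⟩
  · have hval : ∀ m : Message, maxRuleValue ε G |(m : ℝ)| = ε - ε ^ 2 / 3 := fun m =>
      hGv _ ⟨abs_nonneg _, abs_le.2 m.2⟩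
    rw [quackPayoff_eq hε0 hφ (fun _ => rfl) hGc.measurable hGb, hval,
      quackPayoff_eq hε0 hφ (fun _ => rfl) hGc.measurable hGb, hval]
  · set H : ℝ → ℝ := fun x => (g (Set.projIcc 0 1 zero_le_one x) : ℝ)
    have hH : ∀ x : unitInterval, H x = g x := fun x => by simp only [H, Set.projIcc_val]
    have hHm : Measurable H := measurable_subtype_coe.comp
      ((hφ.measurable hε0 hε1).comp continuous_projIcc.measurable)
    have hHb : ∀ x, |H x| ≤ 1 := fun x => by
      rw [abs_of_nonneg (g _).2.1]; exact (g _).2.2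
    have hHv : ∀ a ∈ Set.Ioc (0 : ℝ) 1, maxRuleValue ε H a = maxRuleValue ε H 1 := by
      intro a ha
      have h1 := hind 0 ⟨a, by linarith [ha.1], ha.2⟩ ⟨1, by norm_num, le_rfl⟩
      rw [quackPayoff_eq hε0 hφ hH hHm hHb, quackPayoff_eq hε0 hφ hH hHm hHb,
        abs_of_pos ha.1, abs_one] at h1
      linarith
    funext x
    refine Subtype.ext ?_
    -- The value equation does not determine the rule at 0, where the mass vanishes; symmetry does.
    rcases x.2.1.eq_or_lt with h0 | h0
    · obtain rfl : x = 0 := Subtype.ext h0.symm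
      rw [hφ.apply_zero hε0]; exact hG0.symm
    · rw [← hH]
      exact eq_of_maxRuleValue_const hε0 hε1 hGc.measurable hHm hGb hHb
        (fun a ha => hGv a ⟨ha.1.le, ha.2⟩) hHv ⟨h0, x.2.2⟩
  · ext y
    constructor
    · rintro ⟨x, rfl⟩
      exact ⟨hG0.symm.trans_le (hGmono x.2.1), (hGmono x.2.2).trans_eq hG1⟩
    · intro hy
      rw [← hG0, ← hG1] at hy
      obtain ⟨x, hx, rfl⟩ := intermediate_value_Icc zero_le_one hGc.continuousOn hy
      exact ⟨⟨x, hx⟩, rfl⟩
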